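/- Let $m\ge 1$ and $q\ge 0$ be integers and let $X_1,\dots,X_q$ be Hermitian complex $m\times m$ matrices, not assumed to commute. For each $j$ let $f_j:\mathrm{co}(\sigma(X_j))\to\mathbb{R}$ be a continuous function on the convex hull of the spectrum of $X_j$. For $n\ge 1$ let $$X_j^{(n)}=\frac1n\sum_{k=1}^n \mathbf 1\otimes\dots\otimes X_j\otimes\dots\otimes\mathbf 1\in M_m(\mathbb{C})^{\otimes n}$$ (with $X_j$ in the $k$-th tensor factor), and let $f_j(X_j^{(n)})$ be defined by the functional calculus. Define $C:\mathbb{R}^q\to\mathbb{R}$ and $I:\mathbb{R}^q\to(-\infty,+\infty]$ by $$C(t_1,\dots,t_q)=\ln\mathrm{Tr}\,e^{t_1X_1+\dots+t_qX_q},\qquad I(x)=\sup_{t\in\mathbb{R}^q}\big[t_1x_1+\dots+t_qx_q-C(t)\big].$$ Then the following limit exists in $\mathbb{R}$ and $$\lim_{n\to\infty}\frac1n\ln\mathrm{Tr}\,e^{n[f_1(X_1^{(n)})+\dots+f_q(X_q^{(n)})]}=\sup_{\substack{x\in\mathbb{R}^q:\\ \forall j,\ x_j\in\mathrm{co}(\sigma(X_j))}}\big[f_1(x_1)+\dots+f_q(x_q)-I(x_1,\dots,x_q)\big].$$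 In particular, the right-hand side is an upper bound for the $\limsup$ of the left-hand side, for $q=2$ and for general $q$. -/

import Mathlib

open Filter Topology

noncomputable section

namespace QuantumLD

/-- The elementary tensor `A₁ ⊗ ⋯ ⊗ Aₙ` in `Mₘ(ℂ)^{⊗ n}`, identified (Kronecker product) with the
matrices indexed by the product basis `Fin n → Fin m`. -/
def tensor {m n : ℕ} (A : Fin n → Matrix (Fin m) (Fin m) ℂ) :
    Matrix (Fin n → Fin m) (Fin n → Fin m) ℂ :=
  Matrix.of fun i j => ∏ k, A k (i k) (j k)

/-- `1 ⊗ ⋯ ⊗ X ⊗ ⋯ ⊗ 1`, the copy of `X` in the `k`-th tensor factor. -/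
def site {m n : ℕ} (X : Matrix (Fin m) (Fin m) ℂ) (k : Fin n) :
    Matrix (Fin n → Fin m) (Fin n → Fin m) ℂ :=
  tensor (Function.update (fun _ => 1) k X)

/-- The mean `X^{(n)} = (1/n) (X₁ + ⋯ + Xₙ)`. -/
def mean {m : ℕ} (n : ℕ) (X : Matrix (Fin m) (Fin m) ℂ) :
    Matrix (Fin n → Fin m) (Fin n → Fin m) ℂ :=
  ((n : ℂ)⁻¹) • ∑ k, site X k

/-- `ln Tr e^A`. For Hermitian `A` (the only case used) `Tr e^A` is real, and it is positive when the
index type is nonempty. -/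
def logTrExp {ι : Type*} [Fintype ι] [DecidableEq ι] (A : Matrix ι ι ℂ) : ℝ :=
  Real.log (Matrix.trace (NormedSpace.exp A)).re

/-- The cumulant generating function `C(t₁, …, t_q) = ln Tr exp(t₁ X₁ + ⋯ + t_q X_q)`. -/
def cgf {m q : ℕ} (X : Fin q → Matrix (Fin m) (Fin m) ℂ) (t : Fin q → ℝ) : ℝ :=
  logTrExp (∑ j, (t j : ℂ) • X j)

/-- The Legendre transform `I(x) = sup_t (⟨t, x⟩ - C(t))` of a real function `C` on `ℝ^q`, with
values in the extended reals. -/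
def legendre {q : ℕ} (C : (Fin q → ℝ) → ℝ) (x : Fin q → ℝ) : EReal :=
  ⨆ t : Fin q → ℝ, ((∑ j, t j * x j - C t : ℝ) : EReal)

/-- `X^{(n)}` is Hermitian when `X` is, so its continuous functional calculus is available. -/
theorem mean_isHermitian {m : ℕ} (n : ℕ) {X : Matrix (Fin m) (Fin m) ℂ} (hX : X.IsHermitian) :
    (mean n X).IsHermitian := by
  refine Matrix.IsHermitian.ext fun i j => ?_
  simp only [mean, site, tensor, Matrix.smul_apply, Matrix.sum_apply, Matrix.of_apply, smul_eq_mul,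
    star_mul', star_sum, star_prod]
  congr 1
  · simp
  · refine Finset.sum_congr rfl fun k _ => Finset.prod_congr rfl fun l _ => ?_
    by_cases h : l = k
    · subst h
      simpa using hX.apply (i l) (j l)
    · simp [Function.update_of_ne h, Matrix.one_apply, eq_comm, apply_ite]

end QuantumLD

end

/-! The means `X_j^{(n)}` commute up to `O(1/n)`, so at exponential scale they behave like classical
averages, and the limit is Varadhan's formula with rate function `I`. The two inequalities are
proved separately, after extending each `f_j` to a continuous function on the line.

Upper bound (`eventually_logTrExp_le`). If `V` exceeds the supremum, compactness of the box gives
finitely many slopes `t` such that at every `x` some `t` satisfies `∑ f_j(x_j) - t·x + C(t) < V`.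
Quadratic partitions of unity in each `X_j^{(n)}`, multiplied in a fixed order, give operators `Q_a`
with `∑ Q_a⋆ Q_a = 1`, each localized near one point of the box. There the Hamiltonian lies below an
affine function of the means with one of these slopes. As commutators vanish in norm,
`exists_localization` bounds the Hamiltonian by `∑ Q_a⋆ Λ_a Q_a + o(1)` with `Λ_a` affine.
Monotonicity and Jensen's inequality for `Tr exp` reduce the estimate to the traces of `e^{nΛ_a}`,
which factorize over sites. The number of cells does not depend on `n`.

Lower bound (`eventually_le_logTrExp`). The Peierls–Bogoliubov inequality is applied with the
product Gibbs state of `t·X`. The law of large numbers evaluates the energy at `∇C(t)`, and the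
remaining term is the entropy `C(t) - t·∇C(t)`. Any `x` with `I(x) ≤ B` is approximated by such
gradients with entropy at least `-B`, by minimizing `C(t) - t·x + ε|t|²`. -/

noncomputable section

namespace QuantumLD

open scoped MatrixOrder Matrix.Norms.L2Operator ComplexOrder

/-! ### Trace inequalities for the matrix exponential -/

section TraceInequalities

theorem trace_re_nonneg {ι : Type*} [Fintype ι] {A : Matrix ι ι ℂ} (h : 0 ≤ A) :
    0 ≤ (Matrix.trace A).re :=
  (Complex.nonneg_iff.mp (Matrix.nonneg_iff_posSemidef.mp h).trace_nonneg).1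

theorem trace_re_mono {ι : Type*} [Fintype ι] {A B : Matrix ι ι ℂ} (h : A ≤ B) :
    (Matrix.trace A).re ≤ (Matrix.trace B).re := by
  have := trace_re_nonneg (sub_nonneg.mpr h)
  rw [Matrix.trace_sub, Complex.sub_re] at this
  linarith

theorem conj_diag_re_mono {ι : Type*} [Fintype ι] {A B : Matrix ι ι ℂ} (h : A ≤ B)
    (U : Matrix ι ι ℂ) (i : ι) :
    ((star U * A * U) i i).re ≤ ((star U * B * U) i i).re := by
  have hd := (Complex.nonneg_iff.mp ((Matrix.nonneg_iff_posSemidef.mp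
    (sub_nonneg.mpr (star_left_conjugate_le_conjugate h U))).diag_nonneg (i := i))).1
  simpa using hd

variable {ι : Type*} [Fintype ι] [DecidableEq ι]

theorem exp_eq_cfc {A : Matrix ι ι ℂ} (hA : A.IsHermitian) :
    NormedSpace.exp A = cfc Real.exp A :=
  (CFC.real_exp_eq_normedSpace_exp hA.isSelfAdjoint).symm

/-- The operator form of the tangent line inequality for the exponential. -/
theorem tangent_le_exp {K : Matrix ι ι ℂ} (hK : K.IsHermitian) (s : ℝ) :
    (Real.exp s) • (1 + K - s • 1) ≤ NormedSpace.exp K := by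
  have hK' : IsSelfAdjoint K := hK
  have h : (Real.exp s) • (1 + K - s • 1) = cfc (fun x => Real.exp s * (1 + x - s)) K := by
    rw [cfc_const_mul _ _ K, cfc_sub _ _ K, cfc_const_add (1 : ℝ) _ K, cfc_id' ℝ K,
      cfc_const s K, Algebra.algebraMap_eq_smul_one, Algebra.algebraMap_eq_smul_one, one_smul]
  rw [h, exp_eq_cfc hK]
  refine cfc_mono (fun x _ => ?_)
  have := Real.add_one_le_exp (x - s)
  calc Real.exp s * (1 + x - s) ≤ Real.exp s * Real.exp (x - s) := by
        gcongr; linarith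
    _ = Real.exp x := by rw [← Real.exp_add]; ring_nf

/-- A common eigenbasis for `A` and `e^A` turns the trace inequalities below into scalar comparisons
of diagonal entries. -/
theorem exists_diagonalization {A : Matrix ι ι ℂ} (hA : A.IsHermitian) :
    ∃ (U : Matrix ι ι ℂ) (l : ι → ℝ), star U * U = 1 ∧ U * star U = 1 ∧
      star U * A * U = Matrix.diagonal (fun i => (l i : ℂ)) ∧
      star U * NormedSpace.exp A * U = Matrix.diagonal (fun i => (Real.exp (l i) : ℂ)) := by
  obtain ⟨U, hU⟩ : ∃ U : Matrix ι ι ℂ, U = (hA.eigenvectorUnitary : Matrix ι ι ℂ) := ⟨_, rfl⟩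
  have hUU : star U * U = 1 := hU ▸ Unitary.coe_star_mul_self hA.eigenvectorUnitary
  have hUU' : U * star U = 1 := hU ▸ Unitary.coe_mul_star_self hA.eigenvectorUnitary
  have hAU : star U * A * U = Matrix.diagonal (fun i => (hA.eigenvalues i : ℂ)) := by
    have h := hA.spectral_theorem
    rw [Unitary.conjStarAlgAut_apply, ← hU] at h
    have h2 : star U * A * U = star U * (U * Matrix.diagonal
        (RCLike.ofReal ∘ hA.eigenvalues : ι → ℂ) * star U) * U :=
      congrArg (fun M => star U * M * U) h
    rw [h2]
    calc _ = (star U * U) * Matrix.diagonal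
          (RCLike.ofReal ∘ hA.eigenvalues : ι → ℂ) * (star U * U) := by simp only [mul_assoc]
      _ = _ := by rw [hUU, one_mul, mul_one]; rfl
  refine ⟨U, hA.eigenvalues, hUU, hUU', hAU, ?_⟩
  have hinv : U⁻¹ = star U := Matrix.inv_eq_left_inv hUU
  have h := Matrix.exp_conj' U A ((Matrix.isUnit_iff_isUnit_det U).mpr
    (Matrix.isUnit_det_of_left_inverse hUU))
  rw [hinv, hAU, Matrix.exp_diagonal] at h
  rw [← h]
  congr 1
  ext i
  simp [Pi.coe_exp, Complex.exp_eq_exp_ℂ]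

theorem trace_eq_sum_conj {U : Matrix ι ι ℂ} (hU : U * star U = 1) (M : Matrix ι ι ℂ) :
    (Matrix.trace M).re = ∑ i, ((star U * M * U) i i).re := by
  rw [← Complex.re_sum]
  change _ = (Matrix.trace (star U * M * U)).re
  rw [Matrix.trace_mul_comm, ← mul_assoc, hU, one_mul]

theorem conj_tangent {U : Matrix ι ι ℂ} (hU : star U * U = 1) (A : Matrix ι ι ℂ) (s : ℝ) (i : ι) :
    ((star U * (Real.exp s • (1 + A - s • 1)) * U) i i).re
      = Real.exp s * (1 + ((star U * A * U) i i).re - s) := by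
  have : star U * (Real.exp s • (1 + A - s • 1)) * U
      = Real.exp s • (1 + star U * A * U - s • 1) := by
    rw [mul_smul_comm, smul_mul_assoc]
    congr 1
    rw [mul_sub, mul_add, sub_mul, add_mul, mul_one, hU, mul_smul_comm, smul_mul_assoc, mul_one, hU]
  rw [this]
  simp [-Complex.ofReal_exp]

/-- If `B` dominates every operator tangent line of the exponential at `A`, then
`Tr e^A ≤ Tr B`. -/
theorem trace_exp_le_of_tangent_le {A B : Matrix ι ι ℂ} (hA : A.IsHermitian)
    (h : ∀ s : ℝ, (Real.exp s) • (1 + A - s • 1) ≤ B) :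
    (Matrix.trace (NormedSpace.exp A)).re ≤ (Matrix.trace B).re := by
  obtain ⟨U, l, hU, hU', hAU, hexp⟩ := exists_diagonalization hA
  rw [trace_eq_sum_conj hU', trace_eq_sum_conj hU' B]
  refine Finset.sum_le_sum fun i _ => ?_
  -- The tangent at `s = l i` touches the exponential at this eigenvalue, so nothing is lost in the
  -- `i`-th diagonal entry.
  have hi := conj_diag_re_mono (h (l i)) U i
  rw [conj_tangent hU, hAU] at hi
  rw [hexp]
  simpa [-Complex.ofReal_exp] using hi

/-- The exponential is not operator monotone, but its tangent lines are, and domination of tangent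
lines suffices under the trace. -/
theorem trace_exp_mono {A B : Matrix ι ι ℂ} (hA : A.IsHermitian) (hB : B.IsHermitian)
    (h : A ≤ B) :
    (Matrix.trace (NormedSpace.exp A)).re ≤ (Matrix.trace (NormedSpace.exp B)).re := by
  refine trace_exp_le_of_tangent_le hA fun s => le_trans ?_ (tangent_le_exp hB s)
  exact smul_le_smul_of_nonneg_left (by gcongr) (Real.exp_pos s).le

theorem isSelfAdjoint_exp_half {K : Matrix ι ι ℂ} (hK : K.IsHermitian) :
    IsSelfAdjoint (NormedSpace.exp ((1 / 2 : ℝ) • K)) :=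
  Matrix.IsHermitian.exp (IsSelfAdjoint.smul (IsSelfAdjoint.all _) hK)

theorem exp_half_mul_exp_half (K : Matrix ι ι ℂ) :
    NormedSpace.exp ((1 / 2 : ℝ) • K) * NormedSpace.exp ((1 / 2 : ℝ) • K)
      = NormedSpace.exp K := by
  rw [← Matrix.exp_add_of_commute _ _ (Commute.refl _), ← add_smul]
  norm_num

/-- Jensen's trace inequality for the exponential. -/
theorem trace_exp_sum_conj_le {κ : Type*} (S : Finset κ) (Q K : κ → Matrix ι ι ℂ)
    (hK : ∀ a ∈ S, (K a).IsHermitian) (hQ : ∑ a ∈ S, star (Q a) * Q a = 1) :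
    (Matrix.trace (NormedSpace.exp (∑ a ∈ S, star (Q a) * K a * Q a))).re
      ≤ ∑ a ∈ S, (Matrix.trace (NormedSpace.exp (K a))).re := by
  have hherm : (∑ a ∈ S, star (Q a) * K a * Q a).IsHermitian := by
    change IsSelfAdjoint _
    refine isSelfAdjoint_sum _ fun a ha => ?_
    exact IsSelfAdjoint.conjugate' (hK a ha) (Q a)
  -- The hypothesis bounds `Q⋆Q`; the C⋆-identity transfers the bound to `QQ⋆`, the order that
  -- cyclicity of the trace will produce.
  have hQle : ∀ a ∈ S, Q a * star (Q a) ≤ 1 := by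
    intro a ha
    have h1 : star (Q a) * Q a ≤ 1 := by
      rw [← hQ]
      exact Finset.single_le_sum (f := fun a => star (Q a) * Q a)
        (fun b _ => star_mul_self_nonneg (Q b)) ha
    have h2 : ‖star (Q a) * Q a‖ ≤ 1 :=
      (CStarAlgebra.norm_le_one_iff_of_nonneg _ (star_mul_self_nonneg _)).mpr h1
    rw [← CStarAlgebra.norm_le_one_iff_of_nonneg _ (mul_star_self_nonneg _)]
    rwa [CStarRing.norm_self_mul_star, ← CStarRing.norm_star_mul_self]
  -- Tangent lines are affine, so they pass through the conjugation because the `Q⋆Q` sum to `1`.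
  refine le_trans (trace_exp_le_of_tangent_le (B := ∑ a ∈ S, star (Q a) * NormedSpace.exp (K a) * Q a)
    hherm fun s => ?_) ?_
  · have : (Real.exp s) • (1 + ∑ a ∈ S, star (Q a) * K a * Q a - s • (1 : Matrix ι ι ℂ))
        = ∑ a ∈ S, star (Q a) * (Real.exp s • (1 + K a - s • 1)) * Q a := by
      simp only [mul_smul_comm, smul_mul_assoc, mul_sub, mul_add, sub_mul, add_mul, mul_one,
        ← Finset.smul_sum, Finset.sum_sub_distrib, Finset.sum_add_distrib, hQ]
    rw [this]
    exact Finset.sum_le_sum fun a ha =>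
      star_left_conjugate_le_conjugate (tangent_le_exp (hK a ha) s) (Q a)
  · rw [Matrix.trace_sum, Complex.re_sum]
    refine Finset.sum_le_sum fun a ha => ?_
    set E := NormedSpace.exp ((1 / 2 : ℝ) • K a) with hE
    have hEs : IsSelfAdjoint E := isSelfAdjoint_exp_half (hK a ha)
    have hEE : E * E = NormedSpace.exp (K a) := exp_half_mul_exp_half (K a)
    have h1 : Matrix.trace (star (Q a) * NormedSpace.exp (K a) * Q a)
        = Matrix.trace (star E * (Q a * star (Q a)) * E) := by
      rw [← hEE, hEs.star_eq]
      calc _ = Matrix.trace ((star (Q a) * E) * (E * Q a)) := by simp only [mul_assoc]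
        _ = Matrix.trace ((E * Q a) * (star (Q a) * E)) := Matrix.trace_mul_comm _ _
        _ = _ := by simp only [mul_assoc]
    rw [h1, ← hEE]
    refine trace_re_mono (le_trans (star_left_conjugate_le_conjugate (hQle a ha) E) ?_)
    rw [mul_one, hEs.star_eq]

/-- The Peierls–Bogoliubov inequality, in tangent form. -/
theorem exp_mul_trace_le_trace_exp {H K : Matrix ι ι ℂ} (hH : H.IsHermitian) (hK : K.IsHermitian)
    (u : ℝ) :
    Real.exp u * ((1 - u) * (Matrix.trace (NormedSpace.exp K)).re
      + (Matrix.trace (NormedSpace.exp K * (H - K))).re)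
      ≤ (Matrix.trace (NormedSpace.exp H)).re := by
  obtain ⟨U, l, hU, hU', hKU, hexp⟩ := exists_diagonalization hK
  have h3 : star U * (NormedSpace.exp K * (H - K)) * U
      = (star U * NormedSpace.exp K * U) * (star U * H * U - star U * K * U) := by
    calc _ = star U * NormedSpace.exp K * 1 * (H - K) * U := by simp only [mul_assoc, mul_one]
      _ = _ := by rw [← hU']; simp only [mul_assoc, mul_sub, sub_mul]
  rw [trace_eq_sum_conj hU', trace_eq_sum_conj hU' (NormedSpace.exp H),
    trace_eq_sum_conj hU' (NormedSpace.exp K * (H - K)), h3, hexp, hKU, Finset.mul_sum,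
    ← Finset.sum_add_distrib, Finset.mul_sum]
  refine Finset.sum_le_sum fun i _ => ?_
  -- Shifting the contact point by the same `u` at every eigenvalue of `K` yields the common factor
  -- `e^u`.
  have hi := conj_diag_re_mono (tangent_le_exp hH (l i + u)) U i
  rw [conj_tangent hU] at hi
  refine le_trans (le_of_eq ?_) hi
  rw [Matrix.diagonal_mul]
  simp only [Matrix.diagonal_apply_eq, Matrix.sub_apply, Complex.re_ofReal_mul, Complex.sub_re,
    Complex.ofReal_re, Real.exp_add]
  ring

theorem trace_exp_pos [Nonempty ι] {A : Matrix ι ι ℂ} (hA : A.IsHermitian) :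
    0 < (Matrix.trace (NormedSpace.exp A)).re := by
  obtain ⟨U, l, hU, hU', hAU, hexp⟩ := exists_diagonalization hA
  rw [trace_eq_sum_conj hU', hexp]
  refine Finset.sum_pos (fun i _ => ?_) Finset.univ_nonempty
  simpa [-Complex.ofReal_exp] using Real.exp_pos _

/-- The optimal `u` is the Gibbs expectation of `H - K`: the bracket in the tangent form then
collapses to `Tr e^K`. -/
theorem peierls_bogoliubov [Nonempty ι] {H K : Matrix ι ι ℂ} (hH : H.IsHermitian)
    (hK : K.IsHermitian) :
    logTrExp K + (Matrix.trace (NormedSpace.exp K * (H - K))).re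
      / (Matrix.trace (NormedSpace.exp K)).re ≤ logTrExp H := by
  have hZ := trace_exp_pos hK
  have hZ' := trace_exp_pos hH
  have h := exp_mul_trace_le_trace_exp hH hK
    ((Matrix.trace (NormedSpace.exp K * (H - K))).re / (Matrix.trace (NormedSpace.exp K)).re)
  unfold logTrExp
  rw [← Real.log_exp (_ / _), ← Real.log_mul hZ.ne' (Real.exp_pos _).ne']
  refine Real.log_le_log (by positivity) (le_trans (le_of_eq ?_) h)
  field_simp
  ring

theorem logTrExp_add_smul_one [Nonempty ι] {A : Matrix ι ι ℂ} (hA : A.IsHermitian) (c : ℝ) :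
    logTrExp (A + c • 1) = logTrExp A + c := by
  have h : NormedSpace.exp (A + c • (1 : Matrix ι ι ℂ)) = Real.exp c • NormedSpace.exp A := by
    rw [Matrix.exp_add_of_commute _ _ ((Commute.one_right A).smul_right c)]
    have : c • (1 : Matrix ι ι ℂ) = algebraMap ℝ _ c := (Algebra.algebraMap_eq_smul_one c).symm
    rw [this, ← NormedSpace.algebraMap_exp_comm, ← Real.exp_eq_exp_ℝ,
      Algebra.algebraMap_eq_smul_one, mul_smul_comm, mul_one]
  unfold logTrExp
  rw [h, Matrix.trace_smul, Complex.smul_re, smul_eq_mul,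
    Real.log_mul (Real.exp_pos _).ne' (trace_exp_pos hA).ne', Real.log_exp, add_comm]

end TraceInequalities

/-! ### Tensor powers, single-site operators and means -/

section Tensor

variable {m n : ℕ}

theorem tensor_mul (A B : Fin n → Matrix (Fin m) (Fin m) ℂ) :
    tensor A * tensor B = tensor (fun k => A k * B k) := by
  ext i j
  simp only [tensor, Matrix.mul_apply, Matrix.of_apply, ← Finset.prod_mul_distrib]
  rw [Finset.prod_univ_sum]
  simp

theorem tensor_one : tensor (fun _ : Fin n => (1 : Matrix (Fin m) (Fin m) ℂ)) = 1 := by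
  ext i j
  simp only [tensor, Matrix.of_apply, Matrix.one_apply, Finset.prod_ite_zero, funext_iff]
  simp

theorem trace_tensor (A : Fin n → Matrix (Fin m) (Fin m) ℂ) :
    Matrix.trace (tensor A) = ∏ k, Matrix.trace (A k) := by
  simp only [Matrix.trace, Matrix.diag_apply, tensor, Matrix.of_apply]
  rw [Finset.prod_univ_sum]
  simp

theorem site_apply (X : Matrix (Fin m) (Fin m) ℂ) (k : Fin n) (i j : Fin n → Fin m) :
    site X k i j = X (i k) (j k) * ∏ l ∈ Finset.univ.erase k,
      (1 : Matrix (Fin m) (Fin m) ℂ) (i l) (j l) := by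
  simp only [site, tensor, Matrix.of_apply]
  rw [← Finset.mul_prod_erase _ _ (Finset.mem_univ k)]
  simp only [Function.update_self]
  congr 1
  refine Finset.prod_congr rfl fun l hl => ?_
  rw [Function.update_of_ne (Finset.ne_of_mem_erase hl)]

theorem site_one (k : Fin n) : site (1 : Matrix (Fin m) (Fin m) ℂ) k = 1 := by
  rw [site, ← tensor_one]
  congr 1
  exact Function.update_eq_self k _

theorem site_mul (X Y : Matrix (Fin m) (Fin m) ℂ) (k : Fin n) :
    site (X * Y) k = site X k * site Y k := by
  rw [site, site, site, tensor_mul]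
  congr 1
  ext l : 1
  by_cases h : l = k
  · subst h; simp
  · simp [Function.update_of_ne h]

/-- The embedding of `M_m(ℂ)` as the `k`-th tensor factor, as a star algebra homomorphism. -/
def siteHom (m : ℕ) (k : Fin n) :
    Matrix (Fin m) (Fin m) ℂ →⋆ₐ[ℂ] Matrix (Fin n → Fin m) (Fin n → Fin m) ℂ where
  toFun X := site X k
  map_one' := site_one k
  map_mul' X Y := site_mul X Y k
  map_zero' := by ext i j; simp [site_apply]
  map_add' X Y := by ext i j; simp [site_apply, add_mul]
  commutes' r := by
    rw [Algebra.algebraMap_eq_smul_one, Algebra.algebraMap_eq_smul_one, ← site_one k]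
    ext i j
    simp only [site_apply, Matrix.smul_apply, smul_eq_mul, mul_assoc]
  map_star' X := by
    ext i j
    simp only [site_apply, Matrix.star_apply, star_mul', star_prod]
    congr 1
    refine Finset.prod_congr rfl fun l _ => ?_
    simp [Matrix.one_apply, eq_comm, apply_ite]

theorem siteHom_apply (k : Fin n) (X : Matrix (Fin m) (Fin m) ℂ) : siteHom m k X = site X k := rfl

theorem norm_site_le (X : Matrix (Fin m) (Fin m) ℂ) (k : Fin n) : ‖site X k‖ ≤ ‖X‖ :=
  NonUnitalStarAlgHom.norm_apply_le (siteHom m k) X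

theorem site_commute {k l : Fin n} (h : k ≠ l) (X Y : Matrix (Fin m) (Fin m) ℂ) :
    Commute (site X k) (site Y l) := by
  change _ * _ = _ * _
  rw [site, site, tensor_mul, tensor_mul]
  congr 1
  ext r : 1
  by_cases h1 : r = k
  · subst h1; simp [Function.update_of_ne h]
  · simp [Function.update_of_ne h1]

theorem exp_site (Y : Matrix (Fin m) (Fin m) ℂ) (k : Fin n) :
    NormedSpace.exp (site Y k) = site (NormedSpace.exp Y) k := by
  let _ : NormedAlgebra ℚ (Matrix (Fin m) (Fin m) ℂ) := .restrictScalars ℚ ℂ _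
  have hc : Continuous (siteHom m k) :=
    LinearMap.continuous_of_finiteDimensional (siteHom m k).toAlgHom.toLinearMap
  exact (NormedSpace.map_exp (siteHom m k) hc Y).symm

theorem exp_sum_site (Y : Matrix (Fin m) (Fin m) ℂ) :
    NormedSpace.exp (∑ k : Fin n, site Y k) = tensor (fun _ => NormedSpace.exp Y) := by
  -- Distinct sites commute, so exponentials multiply; partial sums are needed for the induction.
  have h : ∀ S : Finset (Fin n), NormedSpace.exp (∑ k ∈ S, site Y k)
      = tensor (fun k => if k ∈ S then NormedSpace.exp Y else 1) := by
    intro S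
    induction S using Finset.induction_on with
    | empty => simp [NormedSpace.exp_zero, tensor_one]
    | insert k S hk ih =>
      rw [Finset.sum_insert hk, Matrix.exp_add_of_commute, ih, exp_site, site, tensor_mul]
      · congr 1
        ext l : 1
        by_cases hl : l = k
        · subst hl; simp [hk]
        · simp [hl]
      · exact Commute.sum_right _ _ _ fun l hl =>
          site_commute (fun h => hk (by rwa [h])) Y Y
  simpa using h Finset.univ

theorem mean_eq (n : ℕ) (X : Matrix (Fin m) (Fin m) ℂ) :
    mean n X = ((n : ℂ)⁻¹) • ∑ k : Fin n, siteHom m k X := rfl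

/-- `X ↦ X^{(n)}` as a linear map. -/
def meanLin (m n : ℕ) :
    Matrix (Fin m) (Fin m) ℂ →ₗ[ℂ] Matrix (Fin n → Fin m) (Fin n → Fin m) ℂ :=
  ((n : ℂ)⁻¹) • ∑ k : Fin n, (siteHom m k).toAlgHom.toLinearMap

theorem meanLin_apply (n : ℕ) (X : Matrix (Fin m) (Fin m) ℂ) : meanLin m n X = mean n X := by
  simp [meanLin, mean_eq]

theorem norm_mean_le (n : ℕ) (X : Matrix (Fin m) (Fin m) ℂ) : ‖mean n X‖ ≤ ‖X‖ := by
  rcases Nat.eq_zero_or_pos n with rfl | hn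
  · simp [mean]
  rw [mean, norm_smul]
  have h : ‖∑ k : Fin n, site X k‖ ≤ n * ‖X‖ := by
    refine (norm_sum_le_of_le _ (fun k _ => norm_site_le X k)).trans ?_
    simp
  have hn' : (0 : ℝ) < n := by exact_mod_cast hn
  simp only [norm_inv, Complex.norm_natCast]
  calc (n : ℝ)⁻¹ * ‖∑ k : Fin n, site X k‖ ≤ (n : ℝ)⁻¹ * (n * ‖X‖) := by gcongr
    _ = ‖X‖ := by field_simp

theorem mean_one (hn : 0 < n) : mean n (1 : Matrix (Fin m) (Fin m) ℂ) = 1 := by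
  have hn' : (n : ℂ) ≠ 0 := by exact_mod_cast hn.ne'
  simp only [mean, site_one, Finset.sum_const, Finset.card_univ, Fintype.card_fin,
    ← Nat.cast_smul_eq_nsmul ℂ, smul_smul, inv_mul_cancel₀ hn', one_smul]

/-- Means commute up to a factor `1 / n`. -/
theorem mean_commutator (n : ℕ) (X Y : Matrix (Fin m) (Fin m) ℂ) :
    mean n X * mean n Y - mean n Y * mean n X = ((n : ℂ)⁻¹) • mean n (X * Y - Y * X) := by
  have h : (∑ k : Fin n, site X k) * (∑ k : Fin n, site Y k)
      - (∑ k : Fin n, site Y k) * (∑ k : Fin n, site X k)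
      = ∑ k : Fin n, site (X * Y - Y * X) k := by
    rw [Finset.sum_mul_sum, Finset.sum_mul_sum,
      Finset.sum_comm (γ := Fin n) (f := fun i j => site Y i * site X j), ← Finset.sum_sub_distrib]
    refine Finset.sum_congr rfl fun k _ => ?_
    -- Only coinciding sites contribute: `n` terms survive out of `n²`, which is the source of the
    -- factor `1/n`.
    rw [← Finset.sum_sub_distrib, Finset.sum_eq_single k]
    · rw [← siteHom_apply, ← siteHom_apply, ← siteHom_apply, map_sub, map_mul, map_mul]
    · intro l _ hl
      rw [(site_commute hl.symm X Y).eq, sub_self]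
    · simp
  simp only [mean, smul_mul_smul_comm, ← smul_sub, h, smul_smul]

theorem mean_mono (n : ℕ) {X Y : Matrix (Fin m) (Fin m) ℂ} (h : X ≤ Y) : mean n X ≤ mean n Y := by
  rw [mean_eq, mean_eq]
  refine smul_le_smul_of_nonneg_left (Finset.sum_le_sum fun k _ => ?_) (by positivity)
  exact OrderHomClass.mono (siteHom m k) h

/-- The tensor power `ρ^{⊗ n}` pairs with one site as `ρ` does. -/
theorem trace_tensor_mul_site (R X : Matrix (Fin m) (Fin m) ℂ) (k : Fin n) :
    Matrix.trace (tensor (fun _ => R) * site X k)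
      = Matrix.trace (R * X) * Matrix.trace R ^ (n - 1) := by
  rw [site, tensor_mul, trace_tensor, ← Finset.mul_prod_erase _ _ (Finset.mem_univ k)]
  rw [Function.update_self, Finset.prod_congr rfl (g := fun _ => Matrix.trace R)
    (fun l hl => by rw [Function.update_of_ne (Finset.ne_of_mem_erase hl), mul_one])]
  simp

/-- Independence of distinct sites: the trace factorizes and the factor at `k` is zero. This removes
the covariances from the variance of a mean. -/
theorem trace_tensor_mul_site_mul_site {R X : Matrix (Fin m) (Fin m) ℂ} {k l : Fin n}
    (h : k ≠ l) (hX : Matrix.trace (R * X) = 0) (Y : Matrix (Fin m) (Fin m) ℂ) :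
    Matrix.trace (tensor (fun _ => R) * (site X k * site Y l)) = 0 := by
  rw [site, site, tensor_mul, tensor_mul, trace_tensor]
  refine Finset.prod_eq_zero (Finset.mem_univ k) ?_
  rw [Function.update_self, Function.update_of_ne h, mul_one, hX]

end Tensor

/-! ### Asymptotically commuting sequences in C⋆-algebras -/

section Asymptotic

variable {A : ℕ → Type*} [∀ n, CStarAlgebra (A n)]

/-- A sequence of elements of C⋆-algebras is null if its norms tend to zero. -/
def IsNull (a : ∀ n, A n) : Prop := Tendsto (fun n => ‖a n‖) atTop (𝓝 0)

/-- A sequence of elements of C⋆-algebras is bounded if its norms are. -/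
def IsBdd (a : ∀ n, A n) : Prop := ∃ M, ∀ n, ‖a n‖ ≤ M

/-- Two sequences commute asymptotically if their commutators form a null sequence. -/
def AsympCommute (a b : ∀ n, A n) : Prop := IsNull (a * b - b * a)

variable {a b c : ∀ n, A n}

theorem IsNull.zero : IsNull (0 : ∀ n, A n) := by simp [IsNull]

theorem IsNull.add (ha : IsNull a) (hb : IsNull b) : IsNull (a + b) :=
  squeeze_zero (fun _ => norm_nonneg _) (fun n => norm_add_le (a n) (b n))
    (by simpa using Tendsto.add ha hb)

theorem IsNull.neg (ha : IsNull a) : IsNull (-a) := by simpa [IsNull] using ha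

theorem IsNull.sum {κ : Type*} (s : Finset κ) {f : κ → ∀ n, A n} (h : ∀ i ∈ s, IsNull (f i)) :
    IsNull (∑ i ∈ s, f i) :=
  Finset.sum_induction _ _ (fun _ _ => IsNull.add) IsNull.zero h

theorem IsNull.mul_bdd (ha : IsNull a) (hb : IsBdd b) : IsNull (a * b) := by
  obtain ⟨M, hM⟩ := hb
  refine squeeze_zero (g := fun n => ‖a n‖ * M) (fun _ => norm_nonneg _) (fun n => ?_)
    (by simpa using Tendsto.mul_const M ha)
  exact (norm_mul_le _ _).trans (by gcongr; exact hM n)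

theorem IsNull.bdd_mul (ha : IsNull a) (hb : IsBdd b) : IsNull (b * a) := by
  obtain ⟨M, hM⟩ := hb
  refine squeeze_zero (g := fun n => M * ‖a n‖) (fun _ => norm_nonneg _) (fun n => ?_)
    (by simpa using Tendsto.const_mul M ha)
  exact (norm_mul_le _ _).trans (by gcongr; exact hM n)

theorem IsNull.of_approx (h : ∀ ε > 0, ∃ b, IsNull b ∧ ∀ n, ‖a n - b n‖ ≤ ε) : IsNull a := by
  refine Metric.tendsto_atTop.mpr fun ε hε => ?_
  obtain ⟨b, hb, hab⟩ := h (ε / 2) (half_pos hε)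
  obtain ⟨N, hN⟩ := Metric.tendsto_atTop.mp hb (ε / 2) (half_pos hε)
  refine ⟨N, fun n hn => ?_⟩
  have h1 := hN n hn
  rw [Real.dist_0_eq_abs, abs_norm] at h1 ⊢
  have h2 := norm_add_le (a n - b n) (b n)
  rw [sub_add_cancel] at h2
  linarith [hab n]

theorem IsBdd.one : IsBdd (1 : ∀ n, A n) := by
  refine ⟨1, fun n => ?_⟩
  rcases subsingleton_or_nontrivial (A n) with h | h
  · rw [Subsingleton.elim ((1 : ∀ n, A n) n) 0, norm_zero]; exact zero_le_one
  · exact (CStarRing.norm_one (E := A n)).le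

theorem IsBdd.add (ha : IsBdd a) (hb : IsBdd b) : IsBdd (a + b) := by
  obtain ⟨M, hM⟩ := ha
  obtain ⟨N, hN⟩ := hb
  exact ⟨M + N, fun n => (norm_add_le _ _).trans (add_le_add (hM n) (hN n))⟩

theorem IsBdd.mul (ha : IsBdd a) (hb : IsBdd b) : IsBdd (a * b) := by
  obtain ⟨M, hM⟩ := ha
  obtain ⟨N, hN⟩ := hb
  exact ⟨M * N, fun n => (norm_mul_le _ _).trans
    (mul_le_mul (hM n) (hN n) (norm_nonneg _) ((norm_nonneg _).trans (hM n)))⟩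

theorem IsBdd.smul (r : ℝ) (ha : IsBdd a) : IsBdd (r • a) := by
  obtain ⟨M, hM⟩ := ha
  refine ⟨|r| * M, fun n => ?_⟩
  rw [Pi.smul_apply, norm_smul, Real.norm_eq_abs]
  gcongr
  exact hM n

theorem IsBdd.star (ha : IsBdd a) : IsBdd (star a) := by
  obtain ⟨M, hM⟩ := ha
  exact ⟨M, fun n => by simpa using hM n⟩

theorem IsBdd.list_prod {l : List (∀ n, A n)} (h : ∀ b ∈ l, IsBdd b) : IsBdd l.prod := by
  induction l with
  | nil => simpa using IsBdd.one
  | cons b l ih =>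
    rw [List.prod_cons]
    exact (h b (by simp)).mul (ih fun c hc => h c (by simp [hc]))

theorem AsympCommute.symm (h : AsympCommute a b) : AsympCommute b a := by
  simpa [AsympCommute] using IsNull.neg h

theorem AsympCommute.one_right (a : ∀ n, A n) : AsympCommute a 1 := by
  simpa [AsympCommute] using IsNull.zero

theorem AsympCommute.add_right (hb : AsympCommute a b) (hc : AsympCommute a c) :
    AsympCommute a (b + c) := by
  have : a * (b + c) - (b + c) * a = (a * b - b * a) + (a * c - c * a) := by noncomm_ring
  rw [AsympCommute, this]
  exact IsNull.add hb hc

theorem AsympCommute.smul_right (r : ℝ) (hb : AsympCommute a b) : AsympCommute a (r • b) := by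
  rw [AsympCommute, mul_smul_comm, smul_mul_assoc, ← smul_sub]
  simpa [IsNull, norm_smul] using Tendsto.const_mul |r| hb

theorem AsympCommute.mul_right (hb : AsympCommute a b) (hc : AsympCommute a c) (hb' : IsBdd b)
    (hc' : IsBdd c) : AsympCommute a (b * c) := by
  have : a * (b * c) - (b * c) * a = (a * b - b * a) * c + b * (a * c - c * a) := by noncomm_ring
  rw [AsympCommute, this]
  exact (IsNull.mul_bdd hb hc').add (IsNull.bdd_mul hc hb')

theorem AsympCommute.sum_right {κ : Type*} (s : Finset κ) {f : κ → ∀ n, A n}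
    (h : ∀ i ∈ s, AsympCommute a (f i)) : AsympCommute a (∑ i ∈ s, f i) :=
  Finset.sum_induction _ _ (fun _ _ => AsympCommute.add_right)
    (by simpa [AsympCommute] using IsNull.zero) h

theorem AsympCommute.list_prod_right {l : List (∀ n, A n)} (h : ∀ b ∈ l, AsympCommute a b)
    (hl : ∀ b ∈ l, IsBdd b) : AsympCommute a l.prod := by
  induction l with
  | nil => simpa using AsympCommute.one_right a
  | cons b l ih =>
    rw [List.prod_cons]
    exact (h b (by simp)).mul_right (ih (fun c hc => h c (by simp [hc]))
      fun c hc => hl c (by simp [hc])) (hl b (by simp))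
      (IsBdd.list_prod fun c hc => hl c (by simp [hc]))

/-- If `a` annihilates one factor of a product and commutes asymptotically with all factors,
then it annihilates the product asymptotically. -/
theorem IsNull.mul_list_prod {l : List (∀ n, A n)} (h : ∀ b ∈ l, AsympCommute a b)
    (hl : ∀ b ∈ l, IsBdd b) (h0 : ∃ b ∈ l, a * b = 0) : IsNull (a * l.prod) := by
  induction l with
  | nil => simp at h0
  | cons b l ih =>
    have hb := IsBdd.list_prod (l := l) fun c hc => hl c (by simp [hc])
    rw [List.prod_cons]
    by_cases hab : a * b = 0
    · rw [← mul_assoc, hab, zero_mul]; exact IsNull.zero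
    · have h0' : ∃ b ∈ l, a * b = 0 := by
        obtain ⟨c, hc, hc0⟩ := h0
        rcases List.mem_cons.mp hc with rfl | hc
        · exact absurd hc0 hab
        · exact ⟨c, hc, hc0⟩
      have ih' := ih (fun c hc => h c (by simp [hc])) (fun c hc => hl c (by simp [hc])) h0'
      -- `a` moves right past one factor at the cost of a commutator, until it meets the factor it
      -- annihilates.
      have : a * (b * l.prod) = (a * b - b * a) * l.prod + b * (a * l.prod) := by noncomm_ring
      rw [this]
      exact (IsNull.mul_bdd (h b (by simp)) hb).add (ih'.bdd_mul (hl b (by simp)))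

/-- Boundedness is carried through the induction because the Leibniz rule for commutators needs it.
-/
theorem AsympCommute.aeval_right (h : AsympCommute a b) (hb : IsBdd b) (p : Polynomial ℝ) :
    AsympCommute a (Polynomial.aeval b p) ∧ IsBdd (Polynomial.aeval b p) := by
  induction p using Polynomial.induction_on' with
  | add p r hp hr =>
    rw [map_add]
    exact ⟨hp.1.add_right hr.1, hp.2.add hr.2⟩
  | monomial k r =>
    rw [Polynomial.aeval_monomial, ← Algebra.smul_def]
    have : AsympCommute a (b ^ k) ∧ IsBdd (b ^ k) := by
      induction k with
      | zero => rw [pow_zero]; exact ⟨AsympCommute.one_right a, IsBdd.one⟩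
      | succ k ih => rw [pow_succ]; exact ⟨ih.1.mul_right h ih.2 hb, ih.2.mul hb⟩
    exact ⟨this.1.smul_right r, this.2.smul r⟩

theorem norm_le_of_mem_spectrum {B : Type*} [CStarAlgebra B] {b : B} {x : ℝ}
    (hx : x ∈ spectrum ℝ b) : ‖x‖ ≤ ‖b‖ := by
  rcases subsingleton_or_nontrivial B with h | h
  · simp [spectrum.of_subsingleton] at hx
  · exact spectrum.norm_le_norm_of_mem hx

theorem IsBdd.cfc (hb : IsBdd b) {f : ℝ → ℝ}
    (hf : Continuous f) : IsBdd (fun n => cfc f (b n)) := by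
  obtain ⟨M, hM⟩ := hb
  obtain ⟨K, hK⟩ := (isCompact_Icc (a := -M) (b := M)).exists_bound_of_continuousOn hf.continuousOn
  refine ⟨max K 0, fun n => norm_cfc_le (le_max_right _ _) fun x hx => ?_⟩
  have hx' : ‖x‖ ≤ ‖b n‖ := norm_le_of_mem_spectrum hx
  exact (hK x (abs_le.mp (hx'.trans (hM n)))).trans (le_max_left _ _)

/-- Asymptotic commutation passes to continuous functions. -/
theorem AsympCommute.cfc_right (h : AsympCommute a b) (ha : IsBdd a) (hb : IsBdd b)
    (hsa : ∀ n, IsSelfAdjoint (b n)) {f : ℝ → ℝ} (hf : Continuous f) :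
    AsympCommute a (fun n => cfc f (b n)) := by
  obtain ⟨M, hM⟩ := hb
  obtain ⟨K, hK⟩ := ha
  have hK0 : 0 ≤ K := (norm_nonneg _).trans (hK 0)
  refine IsNull.of_approx fun ε hε => ?_
  -- All spectra lie in `[-M, M]`, so one polynomial serves every `n`. The commutator with the error
  -- costs at most `2K` times the tolerance; the `+ 1` covers `K = 0`.
  obtain ⟨p, hp⟩ := exists_polynomial_near_of_continuousOn (-M) M f hf.continuousOn
    (ε / (2 * (K + 1))) (by positivity)
  refine ⟨_, (h.aeval_right ⟨M, hM⟩ p).1, fun n => ?_⟩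
  have hpn : Polynomial.aeval b p n = cfc (fun x => p.eval x) (b n) := by
    rw [cfc_polynomial p (b n)]
    exact (Polynomial.aeval_algHom_apply (Pi.evalAlgHom ℝ A n) b p).symm
  have hd : ‖cfc f (b n) - cfc (fun x => p.eval x) (b n)‖ ≤ ε / (2 * (K + 1)) := by
    rw [← cfc_sub f _ (b n)]
    refine norm_cfc_le (by positivity) fun x hx => ?_
    have hx' : ‖x‖ ≤ ‖b n‖ := norm_le_of_mem_spectrum hx
    have := hp x (abs_le.mp (hx'.trans (hM n)))
    rw [Real.norm_eq_abs, abs_sub_comm]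
    exact this.le
  have he : (a * (fun n => cfc f (b n)) - (fun n => cfc f (b n)) * a) n
      - (a * Polynomial.aeval b p - Polynomial.aeval b p * a) n
      = a n * (cfc f (b n) - cfc (fun x => p.eval x) (b n))
        - (cfc f (b n) - cfc (fun x => p.eval x) (b n)) * a n := by
    simp only [Pi.sub_apply, Pi.mul_apply, hpn]
    noncomm_ring
  rw [he]
  refine (norm_sub_le _ _).trans ?_
  have h1 := (norm_mul_le (a n) (cfc f (b n) - cfc (fun x => p.eval x) (b n))).trans
    (mul_le_mul (hK n) hd (norm_nonneg _) hK0)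
  have h2 := (norm_mul_le (cfc f (b n) - cfc (fun x => p.eval x) (b n)) (a n)).trans
    (mul_le_mul hd (hK n) (norm_nonneg _) (by positivity))
  refine (add_le_add h1 h2).trans ?_
  have : K * (ε / (2 * (K + 1))) + ε / (2 * (K + 1)) * K = ε * (K / (K + 1)) := by
    field_simp
    ring
  rw [this]
  have : K / (K + 1) ≤ 1 := (div_le_one (by positivity)).mpr (by linarith)
  nlinarith

end Asymptotic

/-! ### Operator partitions of unity and localization -/

section Localization

/-- Ordered products of partitions of unity form a partition of unity. -/
theorem sum_star_prod_mul_prod {B κ : Type*} [Ring B] [StarRing B] [Fintype κ] [DecidableEq κ] :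
    ∀ {q : ℕ} (Φ : Fin q → κ → B), (∀ j, ∑ i, star (Φ j i) * Φ j i = 1) →
      ∑ a : Fin q → κ, star (List.ofFn fun j => Φ j (a j)).prod
        * (List.ofFn fun j => Φ j (a j)).prod = 1
  | 0, Φ, _ => by simp
  | q + 1, Φ, h => by
    have ih := sum_star_prod_mul_prod (fun j => Φ j.succ) (fun j => h j.succ)
    -- The leftmost factors are adjacent in `star P * star Φ₀ * Φ₀ * P`, so summing over their index
    -- collapses them without any commutation.
    rw [← (Fin.consEquiv (fun _ => κ)).sum_comp, Fintype.sum_prod_type_right, ← ih]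
    refine Finset.sum_congr rfl fun a _ => ?_
    simp only [List.ofFn_succ, List.prod_cons, Fin.consEquiv_apply, Fin.cons_zero, Fin.cons_succ,
      star_mul]
    set P := (List.ofFn fun j => Φ j.succ (a j)).prod
    calc ∑ i, star P * star (Φ 0 i) * (Φ 0 i * P) = star P * (∑ i, star (Φ 0 i) * Φ 0 i) * P := by
          rw [Finset.mul_sum, Finset.sum_mul]
          simp only [mul_assoc]
      _ = star P * P := by rw [h 0, mul_one]

variable {A : ℕ → Type*} [∀ n, CStarAlgebra (A n)] [∀ n, PartialOrder (A n)]
  [∀ n, StarOrderedRing (A n)]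

/-- Localization: if `H ≤ Λ a + ∑ j, h a j` where `h a j` vanishes on the `j`-th factor of the
localizing operator `Q a`, then `H` is dominated by `∑ a, Q a⋆ Λ a Q a` up to a null sequence. -/
theorem exists_localization {q : ℕ} {κ : Type*} [Fintype κ] [DecidableEq κ]
    (Φ : Fin q → κ → ∀ n, A n) (H : ∀ n, A n) (Λ : (Fin q → κ) → ∀ n, A n)
    (h : (Fin q → κ) → Fin q → ∀ n, A n)
    (hΦ : ∀ j i, IsBdd (Φ j i)) (hΦ1 : ∀ j, ∑ i, star (Φ j i) * Φ j i = 1)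
    (hH : IsSelfAdjoint H) (hHΦ : ∀ j i, AsympCommute H (Φ j i))
    (hh : ∀ a j, IsSelfAdjoint (h a j)) (hhΦ : ∀ a j k i, AsympCommute (h a j) (Φ k i))
    (hh0 : ∀ a j, h a j * Φ j (a j) = 0)
    (hle : ∀ a n, H n ≤ Λ a n + ∑ j, h a j n) :
    ∃ (Q : (Fin q → κ) → ∀ n, A n) (r : ℕ → ℝ), Tendsto r atTop (𝓝 0) ∧
      (∀ n, ∑ a, star (Q a n) * Q a n = 1) ∧
      ∀ n, H n ≤ ∑ a, star (Q a n) * Λ a n * Q a n + r n • 1 := by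
  set Q : (Fin q → κ) → ∀ n, A n := fun a => (List.ofFn fun j => Φ j (a j)).prod with hQ
  have hmem : ∀ a : Fin q → κ, ∀ b ∈ (List.ofFn fun j => Φ j (a j)), ∃ j, b = Φ j (a j) := by
    intro a b hb
    obtain ⟨j, hj⟩ := (List.mem_ofFn' _ _).mp hb
    exact ⟨j, hj.symm⟩
  have hQb : ∀ a, IsBdd (Q a) := fun a => IsBdd.list_prod fun b hb => by
    obtain ⟨j, rfl⟩ := hmem a b hb
    exact hΦ _ _
  have hQ1 : ∑ a, star (Q a) * Q a = 1 := sum_star_prod_mul_prod Φ hΦ1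
  have hHQ : ∀ a, AsympCommute H (Q a) := fun a =>
    AsympCommute.list_prod_right (fun b hb => by obtain ⟨j, rfl⟩ := hmem a b hb; exact hHΦ _ _)
      (fun b hb => by obtain ⟨j, rfl⟩ := hmem a b hb; exact hΦ _ _)
  have hhQ : ∀ a j, IsNull (h a j * Q a) := fun a j =>
    IsNull.mul_list_prod (fun b hb => by obtain ⟨k, rfl⟩ := hmem a b hb; exact hhΦ _ _ _ _)
      (fun b hb => by obtain ⟨k, rfl⟩ := hmem a b hb; exact hΦ _ _)
      ⟨Φ j (a j), (List.mem_ofFn' _ _).mpr ⟨j, rfl⟩, hh0 a j⟩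
  -- `N` collects both errors: moving `H` past the localizers, and the penalties `h a j`, nearly
  -- annihilated by `Q a`.
  set N : ∀ n, A n := (H - ∑ a, star (Q a) * H * Q a)
    + ∑ a, star (Q a) * (∑ j, h a j) * Q a with hN
  have hNnull : IsNull N := by
    refine IsNull.add ?_ ?_
    · have : H - ∑ a, star (Q a) * H * Q a = -∑ a, star (Q a) * (H * Q a - Q a * H) := by
        calc _ = (∑ a, star (Q a) * Q a) * H - ∑ a, star (Q a) * H * Q a := by rw [hQ1, one_mul]
          _ = _ := by
            rw [Finset.sum_mul, ← Finset.sum_sub_distrib, ← Finset.sum_neg_distrib]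
            refine Finset.sum_congr rfl fun a _ => ?_
            noncomm_ring
      rw [this]
      exact (IsNull.sum _ fun a _ => IsNull.bdd_mul (hHQ a) (hQb a).star).neg
    · refine IsNull.sum _ fun a _ => ?_
      rw [mul_assoc, Finset.sum_mul]
      exact (IsNull.sum _ fun j _ => hhQ a j).bdd_mul (hQb a).star
  have hNsa : IsSelfAdjoint N := by
    refine (hH.sub ?_).add ?_
    · exact isSelfAdjoint_sum _ fun a _ => hH.conjugate' (Q a)
    · exact isSelfAdjoint_sum _ fun a _ =>
        (isSelfAdjoint_sum _ fun j _ => hh a j).conjugate' (Q a)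
  refine ⟨Q, fun n => ‖N n‖, hNnull, fun n => ?_, fun n => ?_⟩
  · simpa using congrFun hQ1 n
  · have hNn : IsSelfAdjoint (N n) := congrFun hNsa n
    have h1 : N n ≤ ‖N n‖ • 1 := by
      rw [← Algebra.algebraMap_eq_smul_one]
      exact hNn.le_algebraMap_norm_self
    have h2 : ∑ a, star (Q a n) * H n * Q a n
        ≤ ∑ a, star (Q a n) * (Λ a n + ∑ j, h a j n) * Q a n :=
      Finset.sum_le_sum fun a _ => star_left_conjugate_le_conjugate (hle a n) (Q a n)
    have h3 : H n = ∑ a, star (Q a n) * H n * Q a n + N n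
        - ∑ a, star (Q a n) * (∑ j, h a j n) * Q a n := by
      simp only [hN, Pi.add_apply, Pi.sub_apply, Finset.sum_apply, Pi.mul_apply, Pi.star_apply]
      abel
    calc H n = _ := h3
      _ ≤ ∑ a, star (Q a n) * (Λ a n + ∑ j, h a j n) * Q a n + N n
          - ∑ a, star (Q a n) * (∑ j, h a j n) * Q a n := by gcongr
      _ = ∑ a, star (Q a n) * Λ a n * Q a n + N n := by
        simp only [mul_add, add_mul, Finset.sum_add_distrib]
        abel
      _ ≤ _ := by gcongr

end Localization

/-! ### Partitions of unity, equicontinuity and compactness -/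

section RealAnalysis

/-- A quadratic partition of unity on `[-R, R]` with supports of radius `δ`. -/
theorem exists_sq_partition (R : ℝ) {δ : ℝ} (hδ : 0 < δ) :
    ∃ (N : ℕ) (c : Fin N → ℝ) (φ : Fin N → ℝ → ℝ), (∀ i, Continuous (φ i)) ∧
      (∀ x ∈ Set.Icc (-R) R, ∑ i, φ i x * φ i x = 1) ∧
      ∀ i, ∀ x ∈ Set.Icc (-R) R, φ i x ≠ 0 → |x - c i| < δ := by
  rcases lt_or_ge R 0 with hR | hR
  · exact ⟨0, Fin.elim0, Fin.elim0, fun i => i.elim0,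
      fun x hx => absurd (hx.1.trans hx.2) (by linarith), fun i => i.elim0⟩
  have hRR : -R ≤ R := by linarith
  obtain ⟨s, -, hs⟩ := (isCompact_Icc (a := -R) (b := R)).elim_nhds_subcover
    (fun x => Metric.ball x δ) (fun x _ => Metric.ball_mem_nhds x hδ)
  set c : Fin s.card → ℝ := fun i => s.equivFin.symm i with hc
  set ψ : Fin s.card → ℝ → ℝ := fun i x => max 0 (δ - |x - c i|) with hψ
  have hψc : ∀ i, Continuous (ψ i) := fun i => by simp only [hψ]; fun_prop
  have hψ0 : ∀ i x, 0 ≤ ψ i x := fun i x => le_max_left _ _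
  have hpos : ∀ x ∈ Set.Icc (-R) R, 0 < ∑ i, ψ i x := by
    intro x hx
    obtain ⟨y, hy, hxy⟩ := Set.mem_iUnion₂.mp (hs hx)
    refine Finset.sum_pos' (fun i _ => hψ0 i x) ⟨s.equivFin ⟨y, hy⟩, Finset.mem_univ _, ?_⟩
    have hcy : c (s.equivFin ⟨y, hy⟩) = y := by simp [hc]
    simp only [hψ, hcy]
    rw [Metric.mem_ball, Real.dist_eq] at hxy
    exact lt_max_of_lt_right (by linarith)
  -- The normalizing sum may vanish outside `[-R, R]`; precomposing with the projection keeps each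
  -- `φ i` continuous on all of `ℝ`.
  set p : ℝ → ℝ := fun x => Set.projIcc (-R) R hRR x with hp
  have hpc : Continuous p := continuous_subtype_val.comp continuous_projIcc
  have hpm : ∀ x, p x ∈ Set.Icc (-R) R := fun x => (Set.projIcc (-R) R hRR x).2
  have hpe : ∀ x ∈ Set.Icc (-R) R, p x = x := fun x hx => by
    simp only [hp, Set.projIcc_of_mem hRR hx]
  refine ⟨s.card, c, fun i x => √(ψ i (p x) / ∑ k, ψ k (p x)), fun i => ?_, fun x hx => ?_,
    fun i x hx hne => ?_⟩
  · refine Continuous.sqrt (((hψc i).comp hpc).div ?_ fun x => (hpos _ (hpm x)).ne')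
    exact continuous_finsetSum _ fun k _ => (hψc k).comp hpc
  · simp only [hpe x hx]
    have h1 : ∀ i, √(ψ i x / ∑ k, ψ k x) * √(ψ i x / ∑ k, ψ k x) = ψ i x / ∑ k, ψ k x :=
      fun i => Real.mul_self_sqrt (div_nonneg (hψ0 i x) (hpos x hx).le)
    simp only [h1]
    rw [← Finset.sum_div, div_self (hpos x hx).ne']
  · by_contra hge
    apply hne
    have : ψ i x = 0 := max_eq_left (by linarith)
    simp [hpe x hx, this]

/-- Equicontinuity on a compact interval for finitely many continuous functions. -/
theorem exists_uniform_modulus {κ : Type*} (T : Finset κ) (g : κ → ℝ → ℝ)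
    (hg : ∀ t ∈ T, Continuous (g t)) (R : ℝ) {η : ℝ} (hη : 0 < η) :
    ∃ δ > 0, ∀ t ∈ T, ∀ x ∈ Set.Icc (-R) R, ∀ y ∈ Set.Icc (-R) R, |x - y| < δ →
      |g t x - g t y| ≤ η := by
  have h : ∀ t ∈ T, ∀ᶠ δ in 𝓝[>] (0 : ℝ), ∀ x ∈ Set.Icc (-R) R, ∀ y ∈ Set.Icc (-R) R,
      |x - y| < δ → |g t x - g t y| ≤ η := by
    intro t ht
    have hu := (isCompact_Icc (a := -R) (b := R)).uniformContinuousOn_of_continuous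
      (hg t ht).continuousOn
    obtain ⟨δ, hδ, h⟩ := Metric.uniformContinuousOn_iff.mp hu η hη
    filter_upwards [Ioo_mem_nhdsGT hδ] with d hd x hx y hy hxy
    exact (h x hx y hy (hxy.trans hd.2)).le
  obtain ⟨δ, h1, h2⟩ := (((Filter.eventually_all_finset T).mpr h).and self_mem_nhdsWithin).exists
  exact ⟨δ, h2, h1⟩

/-- A strict pointwise infimum bound on a compact set is realised by finitely many slopes. -/
theorem exists_finset_slopes {q : ℕ} {Ψ : (Fin q → ℝ) → ℝ} (hΨ : Continuous Ψ)
    (C : (Fin q → ℝ) → ℝ) {K : Set (Fin q → ℝ)} (hK : IsCompact K) {V : ℝ}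
    (h : ∀ x ∈ K, ∃ t : Fin q → ℝ, Ψ x - (∑ j, t j * x j - C t) < V) :
    ∃ T : Finset (Fin q → ℝ), ∀ x ∈ K, ∃ t ∈ T, Ψ x - (∑ j, t j * x j - C t) < V := by
  obtain ⟨T, hT⟩ := hK.elim_finite_subcover
    (fun t : Fin q → ℝ => {x | Ψ x - (∑ j, t j * x j - C t) < V})
    (fun t => isOpen_lt (by fun_prop) continuous_const)
    (fun x hx => Set.mem_iUnion.mpr (h x hx))
  exact ⟨T, fun x hx => by simpa using hT hx⟩

end RealAnalysis

/-! ### Exponentials, spectra and commutation of means -/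

section Mean

variable {m : ℕ}

theorem trace_exp_im {ι : Type*} [Fintype ι] [DecidableEq ι] {A : Matrix ι ι ℂ}
    (hA : A.IsHermitian) : (Matrix.trace (NormedSpace.exp A)).im = 0 := by
  have h : star (Matrix.trace (NormedSpace.exp A)) = Matrix.trace (NormedSpace.exp A) := by
    rw [← Matrix.trace_conjTranspose, hA.exp.eq]
  exact Complex.conj_eq_iff_im.mp h

theorem smul_mean {n : ℕ} (hn : 0 < n) (Y : Matrix (Fin m) (Fin m) ℂ) :
    (n : ℂ) • mean n Y = ∑ k : Fin n, site Y k := by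
  have hn' : (n : ℂ) ≠ 0 := by exact_mod_cast hn.ne'
  rw [mean, smul_smul, mul_inv_cancel₀ hn', one_smul]

theorem trace_exp_smul_mean {n : ℕ} (hn : 0 < n) (Y : Matrix (Fin m) (Fin m) ℂ) :
    Matrix.trace (NormedSpace.exp ((n : ℂ) • mean n Y))
      = Matrix.trace (NormedSpace.exp Y) ^ n := by
  rw [smul_mean hn, exp_sum_site, trace_tensor]
  simp

theorem logTrExp_smul_mean {n : ℕ} (hn : 0 < n) {Y : Matrix (Fin m) (Fin m) ℂ}
    (hY : Y.IsHermitian) : logTrExp ((n : ℂ) • mean n Y) = n * logTrExp Y := by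
  have h : Matrix.trace (NormedSpace.exp Y)
      = ((Matrix.trace (NormedSpace.exp Y)).re : ℂ) :=
    Complex.ext (by simp) (by simp [trace_exp_im hY])
  rw [logTrExp, trace_exp_smul_mean hn, h, ← Complex.ofReal_pow, Complex.ofReal_re, Real.log_pow,
    logTrExp]

theorem mean_sum_smul {q : ℕ} (n : ℕ) (X : Fin q → Matrix (Fin m) (Fin m) ℂ) (t : Fin q → ℝ) :
    mean n (∑ j, (t j : ℂ) • X j) = ∑ j, t j • mean n (X j) := by
  rw [← meanLin_apply, map_sum]
  simp [meanLin_apply]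

theorem isHermitian_sum_smul {q : ℕ} {X : Fin q → Matrix (Fin m) (Fin m) ℂ}
    (hX : ∀ j, (X j).IsHermitian) (t : Fin q → ℝ) : (∑ j, (t j : ℂ) • X j).IsHermitian := by
  refine isSelfAdjoint_sum _ fun j _ => ?_
  rw [Complex.coe_smul]
  exact IsSelfAdjoint.smul (IsSelfAdjoint.all _) (hX j)

/-- The spectrum of a mean lies in any interval that bounds the matrix. -/
theorem spectrum_mean_subset {n : ℕ} (hn : 0 < n) {X : Matrix (Fin m) (Fin m) ℂ}
    (hX : X.IsHermitian) {lo hi : ℝ} (h1 : lo • 1 ≤ X) (h2 : X ≤ hi • 1) :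
    spectrum ℝ (mean n X) ⊆ Set.Icc lo hi := by
  have hs : IsSelfAdjoint (mean n X) := mean_isHermitian n hX
  have hc : ∀ r : ℝ, mean n (r • (1 : Matrix (Fin m) (Fin m) ℂ)) = algebraMap ℝ _ r := by
    intro r
    rw [← Complex.coe_smul, ← meanLin_apply, map_smul, meanLin_apply, mean_one hn,
      Complex.coe_smul, Algebra.algebraMap_eq_smul_one]
  have h1' := mean_mono n h1
  have h2' := mean_mono n h2
  rw [hc] at h1' h2'
  exact fun x hx => ⟨(algebraMap_le_iff_le_spectrum hs).mp h1' x hx,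
    (le_algebraMap_iff_spectrum_le hs).mp h2' x hx⟩

/-- The matrix algebras `M_m(ℂ)^{⊗ (n + 1)}`. -/
abbrev TensorAlg (m : ℕ) (n : ℕ) : Type :=
  Matrix (Fin (n + 1) → Fin m) (Fin (n + 1) → Fin m) ℂ

/-- The sequence of means of `X`. -/
def meanSeq (X : Matrix (Fin m) (Fin m) ℂ) : ∀ n, TensorAlg m n := fun n => mean (n + 1) X

theorem isBdd_meanSeq (X : Matrix (Fin m) (Fin m) ℂ) : IsBdd (meanSeq X) :=
  ⟨‖X‖, fun n => norm_mean_le (n + 1) X⟩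

theorem asympCommute_meanSeq (X Y : Matrix (Fin m) (Fin m) ℂ) :
    AsympCommute (meanSeq X) (meanSeq Y) := by
  refine squeeze_zero (g := fun n : ℕ => (1 / ((n : ℝ) + 1)) * ‖X * Y - Y * X‖)
    (fun _ => norm_nonneg _) (fun n => ?_)
    (by simpa using tendsto_one_div_add_atTop_nhds_zero_nat.mul_const ‖X * Y - Y * X‖)
  simp only [Pi.sub_apply, Pi.mul_apply, meanSeq]
  rw [mean_commutator, norm_smul]
  have : ‖((n + 1 : ℕ) : ℂ)⁻¹‖ = 1 / ((n : ℝ) + 1) := by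
    rw [norm_inv, Complex.norm_natCast]; simp
  rw [this]
  gcongr
  exact norm_mean_le _ _

/-- The passage to continuous functions is applied to one entry of the commutator, then to the
other. -/
theorem asympCommute_cfc_meanSeq {X Y : Matrix (Fin m) (Fin m) ℂ} (hX : X.IsHermitian)
    (hY : Y.IsHermitian) {f g : ℝ → ℝ} (hf : Continuous f) (hg : Continuous g) :
    AsympCommute (fun n => cfc f (meanSeq X n)) (fun n => cfc g (meanSeq Y n)) := by
  have h1 : AsympCommute (meanSeq Y) (fun n => cfc f (meanSeq X n)) :=
    (asympCommute_meanSeq Y X).cfc_right (isBdd_meanSeq Y) (isBdd_meanSeq X)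
      (fun n => mean_isHermitian _ hX) hf
  exact h1.symm.cfc_right ((isBdd_meanSeq X).cfc hf) (isBdd_meanSeq Y)
    (fun n => mean_isHermitian _ hY) hg

end Mean

/-! ### Upper bound -/

section UpperBound

variable {m q : ℕ}

/-- Trace inequality for a Hamiltonian localized at finitely many linear Hamiltonians. -/
theorem logTrExp_le_of_localized [NeZero m] {n : ℕ} (hn : 0 < n)
    {X : Fin q → Matrix (Fin m) (Fin m) ℂ} (hX : ∀ j, (X j).IsHermitian)
    {H : Matrix (Fin n → Fin m) (Fin n → Fin m) ℂ} (hH : H.IsHermitian)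
    {κ : Type*} [Fintype κ] (Q : κ → Matrix (Fin n → Fin m) (Fin n → Fin m) ℂ)
    (t : κ → Fin q → ℝ) (W r : ℝ) (hQ : ∑ a, star (Q a) * Q a = 1)
    (hle : H ≤ ∑ a, star (Q a) * (∑ j, t a j • mean n (X j) + (W - cgf X (t a)) • 1) * Q a
      + r • 1) :
    (1 / (n : ℝ)) * logTrExp ((n : ℂ) • H) ≤ W + r + (1 / (n : ℝ)) * Real.log (Fintype.card κ) := by
  have hn' : (0 : ℝ) < n := by exact_mod_cast hn
  set Y : κ → Matrix (Fin m) (Fin m) ℂ := fun a => ∑ j, (t a j : ℂ) • X j with hY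
  have hYh : ∀ a, (Y a).IsHermitian := fun a => isHermitian_sum_smul hX (t a)
  -- The shift cancels the cumulant of the linear part, so every cell contributes exactly `e^{n(W +
  -- r)}`; `r` enters each cell because the `Q⋆Q` sum to `1`.
  set c : κ → ℝ := fun a => n * (W - cgf X (t a) + r) with hc
  set K : κ → Matrix (Fin n → Fin m) (Fin n → Fin m) ℂ :=
    fun a => (n : ℂ) • mean n (Y a) + c a • 1 with hK
  have hn_smul : ∀ M : Matrix (Fin n → Fin m) (Fin n → Fin m) ℂ, (n : ℂ) • M = (n : ℝ) • M :=
    fun M => by rw [← Complex.coe_smul]; simp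
  have hnherm : ∀ {M : Matrix (Fin n → Fin m) (Fin n → Fin m) ℂ}, M.IsHermitian →
      ((n : ℂ) • M).IsHermitian := fun {M} hM => by
    rw [hn_smul]; exact IsSelfAdjoint.smul (IsSelfAdjoint.all _) hM
  have hKh : ∀ a, (K a).IsHermitian := fun a =>
    (hnherm (mean_isHermitian n (hYh a))).add
      (IsSelfAdjoint.smul (IsSelfAdjoint.all (c a)) (IsSelfAdjoint.one _))
  have hle' : (n : ℂ) • H ≤ ∑ a, star (Q a) * K a * Q a := by
    have h1 : (n : ℂ) • H ≤ (n : ℂ) • (∑ a, star (Q a) *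
        (∑ j, t a j • mean n (X j) + (W - cgf X (t a)) • 1) * Q a + r • 1) := by
      rw [hn_smul, hn_smul]
      exact smul_le_smul_of_nonneg_left hle hn'.le
    refine h1.trans (le_of_eq ?_)
    have h0 : r • (1 : Matrix (Fin n → Fin m) (Fin n → Fin m) ℂ)
        = ∑ a, r • (star (Q a) * Q a) := by rw [← Finset.smul_sum, hQ]
    rw [h0, ← Finset.sum_add_distrib, Finset.smul_sum]
    refine Finset.sum_congr rfl fun a _ => ?_
    simp only [hK, hc, hY, mean_sum_smul, hn_smul, mul_add, add_mul, mul_smul_comm,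
      smul_mul_assoc, mul_one]
    module
  have hSh : (∑ a, star (Q a) * K a * Q a).IsHermitian :=
    isSelfAdjoint_sum _ fun a _ => IsSelfAdjoint.conjugate' (hKh a) (Q a)
  have hKtr : ∀ a, (Matrix.trace (NormedSpace.exp (K a))).re = Real.exp (n * (W + r)) := by
    intro a
    have : logTrExp (K a) = n * (W + r) := by
      rw [hK, logTrExp_add_smul_one (hnherm (mean_isHermitian n (hYh a))),
        logTrExp_smul_mean hn (hYh a)]
      simp only [hc, cgf, hY]
      ring
    rw [← this, logTrExp, Real.exp_log (trace_exp_pos (hKh a))]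
  have htr : (Matrix.trace (NormedSpace.exp ((n : ℂ) • H))).re
      ≤ Fintype.card κ * Real.exp (n * (W + r)) := by
    refine (trace_exp_mono (hnherm hH) hSh hle').trans ?_
    refine (trace_exp_sum_conj_le Finset.univ Q K (fun a _ => hKh a) hQ).trans ?_
    simp [hKtr]
  have hpos := trace_exp_pos (hnherm hH)
  have hcard : (Fintype.card κ : ℝ) ≠ 0 := by
    intro h0
    rw [h0, zero_mul] at htr
    linarith
  have hlog := Real.log_le_log hpos htr
  rw [Real.log_mul hcard (Real.exp_pos _).ne', Real.log_exp] at hlog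
  calc (1 / (n : ℝ)) * logTrExp ((n : ℂ) • H)
      ≤ (1 / (n : ℝ)) * (Real.log (Fintype.card κ) + n * (W + r)) := by
        unfold logTrExp; gcongr
    _ = _ := by field_simp; ring

theorem eventually_logTrExp_le [NeZero m] {X : Fin q → Matrix (Fin m) (Fin m) ℂ}
    (hX : ∀ j, (X j).IsHermitian) {F : Fin q → ℝ → ℝ} (hF : ∀ j, Continuous (F j))
    {lo hi : Fin q → ℝ} (hlohi : ∀ j, lo j ≤ hi j) (hlo : ∀ j, lo j • 1 ≤ X j)
    (hhi : ∀ j, X j ≤ hi j • 1) {V : ℝ}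
    (hV : ∀ x ∈ Set.Icc lo hi, ∃ t : Fin q → ℝ,
      ∑ j, F j (x j) - (∑ j, t j * x j - cgf X t) < V) {ε : ℝ} (hε : 0 < ε) :
    ∀ᶠ n : ℕ in atTop, (1 / ((n + 1 : ℕ) : ℝ)) * logTrExp (((n + 1 : ℕ) : ℂ) •
      ∑ j, cfc (F j) (mean (n + 1) (X j))) ≤ V + ε := by
  obtain ⟨T, hT⟩ := exists_finset_slopes (Ψ := fun x => ∑ j, F j (x j)) (by fun_prop) (cgf X)
    (isCompact_Icc (a := lo) (b := hi)) hV
  obtain ⟨R, hR⟩ : ∃ R : ℝ, ∀ j, Set.Icc (lo j) (hi j) ⊆ Set.Icc (-R) R := by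
    refine ⟨∑ j, (|lo j| + |hi j|), fun j => ?_⟩
    have : |lo j| + |hi j| ≤ _ := Finset.single_le_sum (f := fun j => |lo j| + |hi j|)
      (fun j _ => by positivity)
      (Finset.mem_univ j)
    exact Set.Icc_subset_Icc (by linarith [neg_abs_le (lo j), abs_nonneg (hi j)])
      (by linarith [le_abs_self (hi j), abs_nonneg (lo j)])
  -- Each of the `q` coordinates loses `η`, and `q * η < ε` even for `q = 0`.
  set η := ε / (2 * (q + 1)) with hη
  have hη0 : 0 < η := by positivity
  set g : (Fin q → ℝ) → Fin q → ℝ → ℝ := fun t j x => F j x - t j * x with hg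
  have hgc : ∀ t j, Continuous (g t j) := fun t j => by simp only [hg]; fun_prop
  -- The slopes are confined to the finite set `T` first, so that one cell size `δ` suits all of
  -- them.
  obtain ⟨δ, hδ, hmod⟩ := exists_uniform_modulus (T ×ˢ (Finset.univ : Finset (Fin q)))
    (fun p => g p.1 p.2) (fun p _ => hgc _ _) R hη0
  obtain ⟨N, c, φ, hφc, hφ1, hφδ⟩ := exists_sq_partition R hδ
  -- A cell centre may lie outside the box, so it is projected; the projection is 1-Lipschitz and
  -- fixes the box, so distances to box points do not grow.
  set y : (Fin q → Fin N) → Fin q → ℝ :=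
    fun a j => Set.projIcc (lo j) (hi j) (hlohi j) (c (a j)) with hy
  have hymem : ∀ a j, y a j ∈ Set.Icc (lo j) (hi j) := fun a j =>
    (Set.projIcc (lo j) (hi j) (hlohi j) (c (a j))).2
  choose! t htT ht using fun a : Fin q → Fin N =>
    hT (y a) ⟨fun j => (hymem a j).1, fun j => (hymem a j).2⟩
  -- The penalty is the excess of `F j` over its affine bound, and it vanishes on the part of the
  -- box where `φ (a j)` does not.
  set u : (Fin q → Fin N) → Fin q → ℝ → ℝ :=
    fun a j x => max 0 (g (t a) j x - (g (t a) j (y a j) + η)) with hu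
  have huc : ∀ a j, Continuous (u a j) := fun a j => by
    have := hgc (t a) j
    simp only [hu]
    fun_prop
  have hu0 : ∀ a j, ∀ x ∈ Set.Icc (lo j) (hi j), u a j x * φ (a j) x = 0 := by
    intro a j x hx
    by_cases h : φ (a j) x = 0
    · rw [h, mul_zero]
    have h1 := hφδ (a j) x (hR j hx) h
    have h2 : |x - y a j| < δ := by
      refine lt_of_le_of_lt ?_ h1
      have h3 := Set.projIcc_of_mem (hlohi j) hx
      have h4 := Set.abs_projIcc_sub_projIcc (hlohi j) (c := x) (d := c (a j))
      rwa [h3] at h4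
    have h3 := hmod (t a, j) (Finset.mk_mem_product (htT a) (Finset.mem_univ j)) x (hR j hx)
      (y a j) (hR j (hymem a j)) h2
    have h4 : u a j x = 0 := max_eq_left (by linarith [(abs_le.mp h3).2])
    rw [h4, zero_mul]
  have hsa : ∀ j n, IsSelfAdjoint (meanSeq (X j) n) := fun j n => mean_isHermitian _ (hX j)
  have hspec : ∀ j n, spectrum ℝ (meanSeq (X j) n) ⊆ Set.Icc (lo j) (hi j) := fun j n =>
    spectrum_mean_subset n.succ_pos (hX j) (hlo j) (hhi j)
  set H : ∀ n, TensorAlg m n := ∑ j, fun n => cfc (F j) (meanSeq (X j) n) with hH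
  have hHn : ∀ n, H n = ∑ j, cfc (F j) (mean (n + 1) (X j)) := fun n => by
    simp only [hH, Finset.sum_apply]; rfl
  have hcfcsa : ∀ (f : ℝ → ℝ) j, IsSelfAdjoint (fun n => cfc f (meanSeq (X j) n)) := fun f j =>
    funext fun n => (cfc_predicate f (meanSeq (X j) n) : IsSelfAdjoint _)
  have hHsa : IsSelfAdjoint H := isSelfAdjoint_sum _ fun j _ => hcfcsa _ j
  obtain ⟨Q, r, hr, hQ, hloc⟩ := exists_localization
    (fun j i n => cfc (φ i) (meanSeq (X j) n)) H
    (fun a n => ∑ j, t a j • mean (n + 1) (X j) + (V + q * η - cgf X (t a)) • 1)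
    (fun a j n => cfc (u a j) (meanSeq (X j) n))
    (fun j i => (isBdd_meanSeq (X j)).cfc (hφc i))
    (fun j => by
      ext1 n
      simp only [Finset.sum_apply, Pi.mul_apply, Pi.star_apply, Pi.one_apply]
      have h1 : ∀ i, star (cfc (φ i) (meanSeq (X j) n)) * cfc (φ i) (meanSeq (X j) n)
          = cfc (fun x => φ i x * φ i x) (meanSeq (X j) n) := fun i => by
        rw [(cfc_predicate (φ i) (meanSeq (X j) n) : IsSelfAdjoint _).star_eq,
          cfc_mul _ _ _ (hφc i).continuousOn (hφc i).continuousOn]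
      simp only [h1]
      rw [← cfc_sum (fun i x => φ i x * φ i x) _ _
        (fun i _ => ((hφc i).mul (hφc i)).continuousOn)]
      rw [cfc_congr (g := fun _ => 1) fun x hx => by
        simpa using hφ1 x (hR j (hspec j n hx))]
      exact cfc_const_one ℝ _ (hsa j n))
    hHsa
    (fun j i => (AsympCommute.sum_right _ fun k _ =>
      asympCommute_cfc_meanSeq (hX j) (hX k) (hφc i) (hF k)).symm)
    (fun a j => hcfcsa _ j)
    (fun a j k i => asympCommute_cfc_meanSeq (hX j) (hX k) (huc a j) (hφc i))
    (fun a j => by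
      ext1 n
      simp only [Pi.mul_apply, Pi.zero_apply]
      rw [← cfc_mul _ _ _ (huc a j).continuousOn (hφc _).continuousOn,
        cfc_congr (g := fun _ => 0) fun x hx => hu0 a j x (hspec j n hx)]
      exact cfc_const_zero ℝ _)
    (fun a n => by
      have hj : ∀ j, cfc (F j) (meanSeq (X j) n) ≤ t a j • meanSeq (X j) n
          + (g (t a) j (y a j) + η) • 1 + cfc (u a j) (meanSeq (X j) n) := by
        intro j
        have hs := hsa j n
        have he : t a j • meanSeq (X j) n + (g (t a) j (y a j) + η) • 1
            + cfc (u a j) (meanSeq (X j) n) = cfc (fun x => t a j * x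
              + (g (t a) j (y a j) + η) + u a j x) (meanSeq (X j) n) := by
          rw [cfc_add _ (fun x => t a j * x + (g (t a) j (y a j) + η)) (u a j) (by fun_prop)
              (huc a j).continuousOn,
            cfc_add_const _ _ _, cfc_const_mul_id (t a j) _,
            Algebra.algebraMap_eq_smul_one]
        rw [he]
        refine cfc_mono (fun x _ => ?_) (hF j).continuousOn
          (Continuous.continuousOn (by have := huc a j; fun_prop))
        have := le_max_right 0 (g (t a) j x - (g (t a) j (y a j) + η))
        simp only [hu, hg] at this ⊢
        linarith
      have hsum := Finset.sum_le_sum fun j (_ : j ∈ Finset.univ) => hj j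
      rw [hHn]
      refine hsum.trans ?_
      rw [Finset.sum_add_distrib, Finset.sum_add_distrib, ← Finset.sum_smul]
      have hc : ∑ j, (g (t a) j (y a j) + η) ≤ V + q * η - cgf X (t a) := by
        have := ht a
        simp only [hg, Finset.sum_add_distrib, Finset.sum_sub_distrib, Finset.sum_const,
          Finset.card_univ, Fintype.card_fin, nsmul_eq_mul]
        linarith
      have hc' : (∑ j, (g (t a) j (y a j) + η)) • (1 : TensorAlg m n)
          ≤ (V + q * η - cgf X (t a)) • 1 := smul_le_smul_of_nonneg_right hc zero_le_one
      exact add_le_add (add_le_add le_rfl hc') le_rfl)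
  have hlim : Tendsto (fun n : ℕ => V + q * η + r n
      + (1 / ((n + 1 : ℕ) : ℝ)) * Real.log (Fintype.card (Fin q → Fin N))) atTop
      (𝓝 (V + q * η + 0 + 0 * Real.log (Fintype.card (Fin q → Fin N)))) := by
    refine (hr.const_add _).add (Tendsto.mul_const _ ?_)
    simpa using tendsto_one_div_add_atTop_nhds_zero_nat (𝕜 := ℝ)
  have hlt : V + q * η + 0 + 0 * Real.log (Fintype.card (Fin q → Fin N)) < V + ε := by
    have : q * η < ε := by
      rw [hη, ← mul_div_assoc, div_lt_iff₀ (by positivity)]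
      nlinarith [(Nat.cast_nonneg q : (0 : ℝ) ≤ q)]
    linarith
  filter_upwards [hlim.eventually (gt_mem_nhds hlt)] with n hn
  refine le_trans ?_ hn.le
  rw [← hHn]
  exact logTrExp_le_of_localized n.succ_pos hX (congrFun hHsa n) (fun a => Q a n) t _ (r n)
    (hQ n) (hloc n)

end UpperBound

/-! ### Gibbs states -/

section Gibbs

variable {ι : Type*} [Fintype ι] [DecidableEq ι]

/-- The expectation of `A` in the Gibbs state `e^K / Tr e^K`. -/
def gibbs (K A : Matrix ι ι ℂ) : ℝ :=
  (Matrix.trace (NormedSpace.exp K * A)).re / (Matrix.trace (NormedSpace.exp K)).re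

theorem gibbs_sub (K A B : Matrix ι ι ℂ) : gibbs K (A - B) = gibbs K A - gibbs K B := by
  simp [gibbs, mul_sub, sub_div]

theorem gibbs_smul (K A : Matrix ι ι ℂ) (r : ℝ) : gibbs K (r • A) = r * gibbs K A := by
  simp [gibbs, mul_div_assoc]

theorem gibbs_sum {κ : Type*} (s : Finset κ) (K : Matrix ι ι ℂ) (A : κ → Matrix ι ι ℂ) :
    gibbs K (∑ i ∈ s, A i) = ∑ i ∈ s, gibbs K (A i) := by
  simp [gibbs, Finset.mul_sum, Matrix.trace_sum, Finset.sum_div]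

theorem gibbs_one [Nonempty ι] {K : Matrix ι ι ℂ} (hK : K.IsHermitian) : gibbs K 1 = 1 := by
  rw [gibbs, mul_one, div_self (trace_exp_pos hK).ne']

/-- Splitting `e^K` into two self-adjoint halves and using cyclicity turns the expectation into the
trace of a conjugation. -/
theorem gibbs_mono [Nonempty ι] {K : Matrix ι ι ℂ} (hK : K.IsHermitian) {A B : Matrix ι ι ℂ}
    (h : A ≤ B) : gibbs K A ≤ gibbs K B := by
  refine div_le_div_of_nonneg_right ?_ (trace_exp_pos hK).le
  have hEs := isSelfAdjoint_exp_half hK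
  have hE : ∀ M, Matrix.trace (NormedSpace.exp K * M)
      = Matrix.trace (star (NormedSpace.exp ((1 / 2 : ℝ) • K)) * M
        * NormedSpace.exp ((1 / 2 : ℝ) • K)) := fun M => by
    rw [hEs.star_eq, Matrix.trace_mul_comm, mul_assoc, Matrix.trace_mul_comm _ (M * _), mul_assoc,
      exp_half_mul_exp_half]
  rw [hE, hE]
  exact trace_re_mono (star_left_conjugate_le_conjugate h _)

theorem logTrExp_add_gibbs_le [Nonempty ι] {H K : Matrix ι ι ℂ} (hH : H.IsHermitian)
    (hK : K.IsHermitian) : logTrExp K + gibbs K (H - K) ≤ logTrExp H :=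
  peierls_bogoliubov hH hK

end Gibbs

/-! ### Product Gibbs states and the law of large numbers -/

section TensorGibbs

variable {m : ℕ}

theorem mean_eq_real_smul (n : ℕ) (X : Matrix (Fin m) (Fin m) ℂ) :
    mean n X = ((n : ℝ)⁻¹) • ∑ k : Fin n, site X k := by
  rw [mean, ← Complex.coe_smul]
  simp

variable [NeZero m] {n : ℕ}

theorem trace_exp_eq_ofReal {ι : Type*} [Fintype ι] [DecidableEq ι] {A : Matrix ι ι ℂ}
    (hA : A.IsHermitian) :
    Matrix.trace (NormedSpace.exp A) = ((Matrix.trace (NormedSpace.exp A)).re : ℂ) :=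
  Complex.ext (by simp) (by simp [trace_exp_im hA])

theorem gibbs_site (hn : 0 < n) {Y : Matrix (Fin m) (Fin m) ℂ} (hY : Y.IsHermitian)
    (X : Matrix (Fin m) (Fin m) ℂ) (k : Fin n) :
    gibbs ((n : ℂ) • mean n Y) (site X k) = gibbs Y X := by
  have hZ := (trace_exp_pos hY).ne'
  rw [gibbs, gibbs, trace_exp_smul_mean hn, smul_mean hn, exp_sum_site, trace_tensor_mul_site,
    trace_exp_eq_ofReal hY, ← Complex.ofReal_pow, ← Complex.ofReal_pow, Complex.re_mul_ofReal,
    Complex.ofReal_re]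
  obtain ⟨k, rfl⟩ := Nat.exists_eq_succ_of_ne_zero hn.ne'
  rw [Nat.succ_sub_one, pow_succ, Complex.ofReal_re]
  field_simp

theorem gibbs_mean (hn : 0 < n) {Y : Matrix (Fin m) (Fin m) ℂ} (hY : Y.IsHermitian)
    (X : Matrix (Fin m) (Fin m) ℂ) : gibbs ((n : ℂ) • mean n Y) (mean n X) = gibbs Y X := by
  have hn' : (n : ℝ) ≠ 0 := by exact_mod_cast hn.ne'
  rw [mean_eq_real_smul n X, gibbs_smul, gibbs_sum]
  simp only [gibbs_site hn hY]
  simp [hn']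

/-- The variance of a mean in a product Gibbs state. -/
theorem gibbs_mean_mul_mean (hn : 0 < n) {Y D : Matrix (Fin m) (Fin m) ℂ} (hY : Y.IsHermitian)
    (hD : D.IsHermitian) (h0 : gibbs Y D = 0) :
    gibbs ((n : ℂ) • mean n Y) (mean n D * mean n D) = (n : ℝ)⁻¹ * gibbs Y (D * D) := by
  have hn' : (n : ℝ) ≠ 0 := by exact_mod_cast hn.ne'
  have hZ := (trace_exp_pos hY).ne'
  have hre : (Matrix.trace (NormedSpace.exp Y * D)).re = 0 := by
    rcases div_eq_zero_iff.mp h0 with h | h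
    · exact h
    · exact absurd h hZ
  -- `gibbs` records only the real part, while the factorized trace vanishes only if the whole
  -- complex number does.
  have him : (Matrix.trace (NormedSpace.exp Y * D)).im = 0 := by
    have h : star (Matrix.trace (NormedSpace.exp Y * D)) = Matrix.trace (NormedSpace.exp Y * D) := by
      rw [← Matrix.trace_conjTranspose, Matrix.conjTranspose_mul, hY.exp.eq, hD.eq,
        Matrix.trace_mul_comm]
    exact Complex.conj_eq_iff_im.mp h
  have htr : Matrix.trace (NormedSpace.exp Y * D) = 0 := Complex.ext hre him
  have hoff : ∀ k l : Fin n, k ≠ l →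
      gibbs ((n : ℂ) • mean n Y) (site D k * site D l) = 0 := fun k l hkl => by
    rw [gibbs, smul_mean hn, exp_sum_site, trace_tensor_mul_site_mul_site hkl htr, Complex.zero_re,
      zero_div]
  have hk : ∀ k : Fin n, ∑ l : Fin n, gibbs ((n : ℂ) • mean n Y) (site D k * site D l)
      = gibbs Y (D * D) := fun k => by
    rw [Finset.sum_eq_single k (fun l _ hl => hoff k l hl.symm) (by simp), ← site_mul,
      gibbs_site hn hY]
  rw [mean_eq_real_smul n D, smul_mul_smul_comm, gibbs_smul, Finset.sum_mul_sum, gibbs_sum]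
  simp only [gibbs_sum, hk]
  simp
  field_simp

/-- The law of large numbers for a continuous function of a mean in product Gibbs states. -/
theorem eventually_le_gibbs_cfc {X Y : Matrix (Fin m) (Fin m) ℂ} (hX : X.IsHermitian)
    (hY : Y.IsHermitian) {F : ℝ → ℝ} (hF : Continuous F) {ε : ℝ} (hε : 0 < ε) :
    ∀ᶠ n : ℕ in atTop, F (gibbs Y X) - ε ≤
      gibbs (((n + 1 : ℕ) : ℂ) • mean (n + 1) Y) (cfc F (mean (n + 1) X)) := by
  set x := gibbs Y X with hx
  obtain ⟨δ, hδ, hδF⟩ := Metric.continuous_iff.mp hF x (ε / 2) (half_pos hε)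
  obtain ⟨B, hB⟩ := (isCompact_Icc (a := -‖X‖) (b := ‖X‖)).exists_bound_of_continuousOn
    hF.continuousOn
  have hB0 : 0 ≤ B := (norm_nonneg _).trans (hB 0 ⟨by simp, norm_nonneg X⟩)
  -- Chebyshev's constant: beyond distance `δ` the quadratic term is at least `B + |F x|`, enough
  -- for the minorant to stay below `F`.
  set M := (B + |F x|) / δ ^ 2 with hM
  have hM0 : 0 ≤ M := by positivity
  have hpt : ∀ y ∈ Set.Icc (-‖X‖) ‖X‖, F x - ε / 2 - M * ((y - x) * (y - x)) ≤ F y := by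
    intro y hy
    by_cases hyx : |y - x| < δ
    · have h1 := hδF y hyx
      rw [Real.dist_eq] at h1
      have h2 := mul_nonneg hM0 (mul_self_nonneg (y - x))
      linarith [(abs_lt.mp h1).1]
    · have h1 : δ ^ 2 ≤ (y - x) * (y - x) := by
        rw [← abs_mul_abs_self (y - x), pow_two]
        have := not_lt.mp hyx
        gcongr
      have h2 : B + |F x| ≤ M * ((y - x) * (y - x)) := by
        calc B + |F x| = M * δ ^ 2 := by rw [hM]; field_simp
          _ ≤ _ := by gcongr
      have h3 := hB y hy
      rw [Real.norm_eq_abs] at h3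
      linarith [neg_abs_le (F y), le_abs_self (F x)]
  set D := X - x • (1 : Matrix (Fin m) (Fin m) ℂ) with hD
  have hDh : D.IsHermitian := IsSelfAdjoint.sub hX
    (IsSelfAdjoint.smul (IsSelfAdjoint.all x) (IsSelfAdjoint.one _))
  have hD0 : gibbs Y D = 0 := by rw [hD, gibbs_sub, gibbs_smul, gibbs_one hY, ← hx]; ring
  have hlim : Tendsto (fun n : ℕ => F x - ε / 2 - M * (((n + 1 : ℕ) : ℝ)⁻¹ * gibbs Y (D * D)))
      atTop (𝓝 (F x - ε / 2 - M * (0 * gibbs Y (D * D)))) := by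
    refine Tendsto.const_sub _ (Tendsto.const_mul _ (Tendsto.mul_const _ ?_))
    simpa using tendsto_one_div_add_atTop_nhds_zero_nat (𝕜 := ℝ)
  have hlt : F x - ε < F x - ε / 2 - M * (0 * gibbs Y (D * D)) := by
    rw [zero_mul, mul_zero]; linarith
  filter_upwards [hlim.eventually (lt_mem_nhds hlt)] with n hn
  refine hn.le.trans ?_
  have hs : IsSelfAdjoint (mean (n + 1) X) := mean_isHermitian _ hX
  have hKh : (((n + 1 : ℕ) : ℂ) • mean (n + 1) Y).IsHermitian := by
    have : ((n + 1 : ℕ) : ℂ) • mean (n + 1) Y = ((n + 1 : ℕ) : ℝ) • mean (n + 1) Y := by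
      rw [← Complex.coe_smul]; simp
    rw [this]
    exact IsSelfAdjoint.smul (IsSelfAdjoint.all _) (mean_isHermitian _ hY)
  have hmD : mean (n + 1) D = mean (n + 1) X - x • 1 := by
    rw [hD, ← meanLin_apply, map_sub, meanLin_apply, ← Complex.coe_smul, map_smul, meanLin_apply,
      mean_one n.succ_pos, Complex.coe_smul]
  have hle : (F x - ε / 2) • 1 - M • (mean (n + 1) D * mean (n + 1) D)
      ≤ cfc F (mean (n + 1) X) := by
    have he : (F x - ε / 2) • 1 - M • (mean (n + 1) D * mean (n + 1) D)
        = cfc (fun y => F x - ε / 2 - M * ((y - x) * (y - x))) (mean (n + 1) X) := by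
      rw [cfc_sub (fun _ => F x - ε / 2) (fun y => M * ((y - x) * (y - x))) _,
        cfc_const_mul M (fun y => (y - x) * (y - x)) _, cfc_mul _ _ _,
        cfc_sub (fun y => y) (fun _ => x) _, cfc_id' ℝ _, cfc_const _ _, cfc_const _ _,
        Algebra.algebraMap_eq_smul_one, Algebra.algebraMap_eq_smul_one, hmD]
    rw [he]
    refine cfc_mono (fun y hy => hpt y ?_) (by fun_prop) hF.continuousOn
    exact abs_le.mp ((norm_le_of_mem_spectrum hy).trans (norm_mean_le _ X))
  have h := gibbs_mono hKh hle
  rwa [gibbs_sub, gibbs_smul, gibbs_smul, gibbs_one hKh,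
    gibbs_mean_mul_mean n.succ_pos hY hDh hD0, mul_one] at h

end TensorGibbs

/-! ### Lower bound -/

section LowerBound

variable {m q : ℕ}

/-- The gradient of the cumulant generating function: the expectation of `X j` in the Gibbs state
of `∑ j, t j X j`. -/
def cgfGrad (X : Fin q → Matrix (Fin m) (Fin m) ℂ) (t : Fin q → ℝ) (j : Fin q) : ℝ :=
  gibbs (∑ j, (t j : ℂ) • X j) (X j)

theorem gibbs_sum_smul (X : Fin q → Matrix (Fin m) (Fin m) ℂ) (t s : Fin q → ℝ) :
    gibbs (∑ j, (t j : ℂ) • X j) (∑ j, (s j : ℂ) • X j) = ∑ j, s j * cgfGrad X t j := by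
  simp only [gibbs_sum, Complex.coe_smul (E := Matrix (Fin m) (Fin m) ℂ), gibbs_smul, cgfGrad]

theorem continuous_exp_sum_smul (X : Fin q → Matrix (Fin m) (Fin m) ℂ) :
    Continuous fun t : Fin q → ℝ => NormedSpace.exp (∑ j, (t j : ℂ) • X j) := by
  let _ : NormedAlgebra ℚ (Matrix (Fin m) (Fin m) ℂ) := .restrictScalars ℚ ℂ _
  exact NormedSpace.exp_continuous.comp (by fun_prop)

variable [NeZero m]

/-- Peierls–Bogoliubov between two linear Hamiltonians: `cgfGrad` is a subgradient, so `cgf` need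
not be differentiated. -/
theorem cgf_add_le {X : Fin q → Matrix (Fin m) (Fin m) ℂ} (hX : ∀ j, (X j).IsHermitian)
    (t s : Fin q → ℝ) : cgf X t + ∑ j, (s j - t j) * cgfGrad X t j ≤ cgf X s := by
  have h := logTrExp_add_gibbs_le (isHermitian_sum_smul hX s) (isHermitian_sum_smul hX t)
  rw [gibbs_sub, gibbs_sum_smul, gibbs_sum_smul, ← Finset.sum_sub_distrib] at h
  simpa only [sub_mul, cgf] using h

theorem continuous_cgf {X : Fin q → Matrix (Fin m) (Fin m) ℂ} (hX : ∀ j, (X j).IsHermitian) :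
    Continuous (cgf X) :=
  Continuous.log (Complex.continuous_re.comp (continuous_exp_sum_smul X).matrix_trace)
    fun t => (trace_exp_pos (isHermitian_sum_smul hX t)).ne'

theorem continuous_cgfGrad {X : Fin q → Matrix (Fin m) (Fin m) ℂ} (hX : ∀ j, (X j).IsHermitian)
    (j : Fin q) : Continuous fun t => cgfGrad X t j :=
  (Complex.continuous_re.comp
    ((continuous_exp_sum_smul X).mul continuous_const).matrix_trace).div
    (Complex.continuous_re.comp (continuous_exp_sum_smul X).matrix_trace)
    fun t => (trace_exp_pos (isHermitian_sum_smul hX t)).ne'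

/-- First-order condition for a regularised Legendre transform. -/
theorem cgfGrad_eq_of_isMin {X : Fin q → Matrix (Fin m) (Fin m) ℂ} (hX : ∀ j, (X j).IsHermitian)
    {x t : Fin q → ℝ} {ε : ℝ}
    (hmin : ∀ s, cgf X t - ∑ j, t j * x j + ε * ∑ j, t j ^ 2
      ≤ cgf X s - ∑ j, s j * x j + ε * ∑ j, s j ^ 2) (j : Fin q) :
    cgfGrad X t j = x j - 2 * ε * t j := by
  set γ : ℝ → Fin q → ℝ := fun h => Function.update t j (t j + h) with hγ
  have hγc : Continuous γ := continuous_const.update j (by fun_prop)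
  have hγ0 : γ 0 = t := by simp [hγ]
  have hsum : ∀ (h : ℝ) (f : Fin q → ℝ → ℝ),
      ∑ k, f k (γ h k) = ∑ k, f k (t k) + (f j (t j + h) - f j (t j)) := by
    intro h f
    rw [← Finset.add_sum_erase _ _ (Finset.mem_univ j),
      ← Finset.add_sum_erase _ (fun k => f k (t k)) (Finset.mem_univ j),
      Finset.sum_congr rfl (g := fun k => f k (t k)) fun k hk => by
        simp only [hγ, Function.update_of_ne (Finset.ne_of_mem_erase hk)]]
    simp only [hγ, Function.update_self]
    ring
  -- The subgradient is taken at the perturbed point. Dividing by `h` of either sign and letting `h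
  -- → 0` gives both inequalities by continuity of `cgfGrad`.
  have key : ∀ h : ℝ, h * (x j - 2 * ε * t j - ε * h) ≤ h * cgfGrad X (γ h) j := by
    intro h
    have h1 := hmin (γ h)
    have h2 := cgf_add_le hX (γ h) t
    have h3 := hsum h (fun k y => y * x k)
    have h4 := hsum h (fun _ y => y ^ 2)
    have h5 := hsum h (fun k y => (t k - y) * cgfGrad X (γ h) k)
    simp only [sub_self, zero_mul, Finset.sum_const_zero, zero_add] at h3 h4 h5
    rw [h5] at h2
    rw [h3, h4] at h1
    nlinarith
  have hg : Tendsto (fun h => cgfGrad X (γ h) j) (𝓝 0) (𝓝 (cgfGrad X t j)) := by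
    have := ((continuous_cgfGrad hX j).comp hγc).tendsto 0
    rw [Function.comp_apply, hγ0] at this
    exact this
  have hl : Tendsto (fun h : ℝ => x j - 2 * ε * t j - ε * h) (𝓝 0) (𝓝 (x j - 2 * ε * t j)) := by
    have : Continuous fun h : ℝ => x j - 2 * ε * t j - ε * h := by fun_prop
    simpa using this.tendsto 0
  refine le_antisymm ?_ ?_
  · refine le_of_tendsto_of_tendsto (b := 𝓝[<] (0 : ℝ)) (hg.mono_left nhdsWithin_le_nhds)
      (hl.mono_left nhdsWithin_le_nhds) ?_
    filter_upwards [self_mem_nhdsWithin] with h hh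
    exact (mul_le_mul_left_of_neg hh).mp (key h)
  · refine le_of_tendsto_of_tendsto (b := 𝓝[>] (0 : ℝ)) (hl.mono_left nhdsWithin_le_nhds)
      (hg.mono_left nhdsWithin_le_nhds) ?_
    filter_upwards [self_mem_nhdsWithin] with h hh
    exact le_of_mul_le_mul_left (key h) hh

/-- A point where the rate function is finite is approximated by Gibbs states of at least the
corresponding entropy. -/
theorem exists_cgfGrad_near {X : Fin q → Matrix (Fin m) (Fin m) ℂ} (hX : ∀ j, (X j).IsHermitian)
    {x : Fin q → ℝ} {B : ℝ} (hB : ∀ t : Fin q → ℝ, ∑ j, t j * x j - cgf X t ≤ B) {δ : ℝ}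
    (hδ : 0 < δ) :
    ∃ t : Fin q → ℝ, (∀ j, |cgfGrad X t j - x j| < δ) ∧
      -B ≤ cgf X t - ∑ j, t j * cgfGrad X t j := by
  have hCB : 0 ≤ cgf X 0 + B := by
    have := hB 0
    simp only [Pi.zero_apply, zero_mul, Finset.sum_const_zero] at this
    linarith
  -- At the minimizer the gradient misses `x j` by `2 * ε * t j`, whose square is `4ε · (ε t_j²) ≤
  -- 4ε(C(0) + B)`.
  obtain ⟨ε, hε, hεδ⟩ : ∃ ε > 0, 4 * ε * (cgf X 0 + B) < δ ^ 2 := by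
    refine ⟨δ ^ 2 / (4 * (cgf X 0 + B + 1)), by positivity, ?_⟩
    rw [mul_div_assoc', div_mul_eq_mul_div, div_lt_iff₀ (by positivity)]
    nlinarith [pow_pos hδ 2]
  set Ψ : (Fin q → ℝ) → ℝ := fun t => cgf X t - ∑ j, t j * x j + ε * ∑ j, t j ^ 2 with hΨ
  have hΨc : Continuous Ψ := by
    have := continuous_cgf hX
    simp only [hΨ]
    fun_prop
  have hlow : ∀ t, Ψ t ≤ Ψ 0 → ∀ j, ε * t j ^ 2 ≤ cgf X 0 + B := by
    intro t ht j
    have h1 := hB t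
    have h2 := Finset.single_le_sum (f := fun j => t j ^ 2) (fun j _ => sq_nonneg (t j))
      (Finset.mem_univ j)
    have h3 : ε * t j ^ 2 ≤ ε * ∑ j, t j ^ 2 := by gcongr
    have h4 : Ψ 0 = cgf X 0 := by simp [hΨ]
    rw [h4] at ht
    simp only [hΨ] at ht
    linarith
  obtain ⟨t, ht⟩ := hΨc.exists_forall_le_of_isBounded 0 (by
    refine (Metric.isBounded_closedBall (x := (0 : Fin q → ℝ))
      (r := √((cgf X 0 + B) / ε))).subset fun t ht => ?_
    rw [mem_closedBall_zero_iff, pi_norm_le_iff_of_nonneg (Real.sqrt_nonneg _)]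
    intro j
    refine Real.abs_le_sqrt ?_
    rw [le_div_iff₀ hε, mul_comm]
    exact hlow t ht j)
  have hgrad := cgfGrad_eq_of_isMin hX ht
  refine ⟨t, fun j => ?_, ?_⟩
  · rw [hgrad j]
    refine abs_lt_of_sq_lt_sq ?_ hδ.le
    have := hlow t (ht 0) j
    nlinarith
  · have h1 := hB t
    have h2 : ∑ j, t j * cgfGrad X t j = ∑ j, t j * x j - 2 * ε * ∑ j, t j ^ 2 := by
      rw [Finset.mul_sum, ← Finset.sum_sub_distrib]
      exact Finset.sum_congr rfl fun j _ => by rw [hgrad j]; ring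
    have h3 : 0 ≤ ε * ∑ j, t j ^ 2 := by positivity
    rw [h2]
    linarith

theorem eventually_le_logTrExp {X : Fin q → Matrix (Fin m) (Fin m) ℂ}
    (hX : ∀ j, (X j).IsHermitian) {F : Fin q → ℝ → ℝ} (hF : ∀ j, Continuous (F j))
    {x : Fin q → ℝ} {B : ℝ} (hB : ∀ t : Fin q → ℝ, ∑ j, t j * x j - cgf X t ≤ B) {ε : ℝ}
    (hε : 0 < ε) :
    ∀ᶠ n : ℕ in atTop, ∑ j, F j (x j) - B - ε ≤ (1 / ((n + 1 : ℕ) : ℝ)) *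
      logTrExp (((n + 1 : ℕ) : ℂ) • ∑ j, cfc (F j) (mean (n + 1) (X j))) := by
  have hΨ : Continuous fun y : Fin q → ℝ => ∑ j, F j (y j) := by fun_prop
  obtain ⟨δ, hδ, hclose⟩ := Metric.continuous_iff.mp hΨ x (ε / 2) (half_pos hε)
  obtain ⟨t, htx, htB⟩ := exists_cgfGrad_near hX hB hδ
  have h1 : ∑ j, F j (x j) - ε / 2 ≤ ∑ j, F j (cgfGrad X t j) := by
    have := hclose (cgfGrad X t) ((dist_pi_lt_iff hδ).mpr htx)
    rw [Real.dist_eq] at this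
    linarith [(abs_lt.mp this).1]
  set η := ε / (2 * (q + 1)) with hη
  have hη0 : 0 < η := by positivity
  have hqη : q * η ≤ ε / 2 := by
    rw [hη, ← mul_div_assoc, div_le_div_iff₀ (by positivity) two_pos]
    nlinarith
  set Y := ∑ j, (t j : ℂ) • X j with hY
  have hYh : Y.IsHermitian := isHermitian_sum_smul hX t
  filter_upwards [eventually_all.mpr fun j => eventually_le_gibbs_cfc (hX j) hYh (hF j) hη0]
    with n hn
  set H := ∑ j, cfc (F j) (mean (n + 1) (X j)) with hH
  have hsm : ∀ M : TensorAlg m n, ((n + 1 : ℕ) : ℂ) • M = ((n + 1 : ℕ) : ℝ) • M := fun M => by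
    rw [← Complex.coe_smul]; simp
  have hHh : (((n + 1 : ℕ) : ℂ) • H).IsHermitian := by
    rw [hsm]
    exact IsSelfAdjoint.smul (IsSelfAdjoint.all _) (isSelfAdjoint_sum _ fun j _ =>
      (cfc_predicate (F j) (mean (n + 1) (X j)) : IsSelfAdjoint _))
  have hKh : (((n + 1 : ℕ) : ℂ) • mean (n + 1) Y).IsHermitian := by
    rw [hsm]
    exact IsSelfAdjoint.smul (IsSelfAdjoint.all _) (mean_isHermitian _ hYh)
  -- In the product state every term is `n` times a one-site quantity except the expectation of `H`,
  -- which the law of large numbers bounds below.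
  have hpb := logTrExp_add_gibbs_le hHh hKh
  rw [logTrExp_smul_mean n.succ_pos hYh, gibbs_sub, hsm H,
    congrArg (gibbs _) (hsm (mean (n + 1) Y)), gibbs_smul, gibbs_smul,
    gibbs_mean n.succ_pos hYh, hY, gibbs_sum_smul, ← hY, ← hsm H] at hpb
  have hHlow : ∑ j, F j (cgfGrad X t j) - q * η
      ≤ gibbs (((n + 1 : ℕ) : ℂ) • mean (n + 1) Y) H := by
    rw [hH, gibbs_sum]
    have := Finset.sum_le_sum fun j (_ : j ∈ Finset.univ) => hn j
    rwa [Finset.sum_sub_distrib, Finset.sum_const, Finset.card_univ, Fintype.card_fin,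
      nsmul_eq_mul] at this
  have hn0 : (0 : ℝ) < ((n + 1 : ℕ) : ℝ) := by positivity
  rw [one_div, ← div_eq_inv_mul, le_div_iff₀ hn0]
  refine le_trans ?_ hpb
  have hcgf : cgf X t = logTrExp Y := rfl
  rw [hcgf] at htB
  have : ∑ j, F j (x j) - B - ε ≤ logTrExp Y
      + (gibbs (((n + 1 : ℕ) : ℂ) • mean (n + 1) Y) H - ∑ j, t j * cgfGrad X t j) := by linarith
  calc _ ≤ (logTrExp Y + (gibbs (((n + 1 : ℕ) : ℂ) • mean (n + 1) Y) H
        - ∑ j, t j * cgfGrad X t j)) * ((n + 1 : ℕ) : ℝ) := by gcongr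
    _ = _ := by ring

end LowerBound

/-! ### Convex hull of the spectrum and continuous extension -/

section SpectralInterval

theorem exists_convexHull_spectrum_eq_Icc {m : ℕ} [NeZero m] {X : Matrix (Fin m) (Fin m) ℂ}
    (hX : X.IsHermitian) :
    ∃ lo hi : ℝ, lo ≤ hi ∧ convexHull ℝ (spectrum ℝ X) = Set.Icc lo hi ∧ lo • 1 ≤ X ∧
      X ≤ hi • 1 := by
  have hs : IsSelfAdjoint X := hX
  have hne : (spectrum ℝ X).Nonempty := ContinuousFunctionalCalculus.spectrum_nonempty X hs
  have hc : IsCompact (spectrum ℝ X) := ContinuousFunctionalCalculus.isCompact_spectrum X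
  have hsub : spectrum ℝ X ⊆ Set.Icc (sInf (spectrum ℝ X)) (sSup (spectrum ℝ X)) :=
    fun x hx => ⟨csInf_le hc.bddBelow hx, le_csSup hc.bddAbove hx⟩
  refine ⟨sInf (spectrum ℝ X), sSup (spectrum ℝ X), ?_, ?_, ?_, ?_⟩
  · obtain ⟨x, hx⟩ := hne
    exact (hsub hx).1.trans (hsub hx).2
  · refine (convexHull_min hsub (convex_Icc _ _)).antisymm ?_
    exact (convex_convexHull ℝ _).ordConnected.out
      (subset_convexHull ℝ _ (hc.sInf_mem hne)) (subset_convexHull ℝ _ (hc.sSup_mem hne))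
  · rw [← Algebra.algebraMap_eq_smul_one, algebraMap_le_iff_le_spectrum hs]
    exact fun x hx => (hsub hx).1
  · rw [← Algebra.algebraMap_eq_smul_one, le_algebraMap_iff_spectrum_le hs]
    exact fun x hx => (hsub hx).2

theorem exists_continuous_eqOn_Icc {f : ℝ → ℝ} {lo hi : ℝ} (h : lo ≤ hi)
    (hf : ContinuousOn f (Set.Icc lo hi)) :
    ∃ F : ℝ → ℝ, Continuous F ∧ Set.EqOn F f (Set.Icc lo hi) :=
  ⟨fun x => f (Set.projIcc lo hi h x),
    (continuousOn_iff_continuous_domRestrict.mp hf).comp continuous_projIcc,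
    fun x hx => by simp only [Set.projIcc_of_mem h hx]⟩

end SpectralInterval

/-! ### Extended-real Legendre transform -/

section Legendre

variable {q : ℕ}

theorem le_legendre (C : (Fin q → ℝ) → ℝ) (x t : Fin q → ℝ) :
    ((∑ j, t j * x j - C t : ℝ) : EReal) ≤ legendre C x :=
  le_iSup (fun t : Fin q → ℝ => ((∑ j, t j * x j - C t : ℝ) : EReal)) t

theorem legendre_ne_bot (C : (Fin q → ℝ) → ℝ) (x : Fin q → ℝ) : legendre C x ≠ ⊥ :=
  fun h => EReal.coe_ne_bot _ (le_bot_iff.mp (h ▸ le_legendre C x 0))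

theorem coe_sub_legendre_le (C : (Fin q → ℝ) → ℝ) (x t : Fin q → ℝ) (r : ℝ) :
    (r : EReal) - legendre C x ≤ ((r - (∑ j, t j * x j - C t) : ℝ) : EReal) := by
  rw [EReal.coe_sub]
  exact EReal.sub_le_sub le_rfl (le_legendre C x t)

/-- A strict bound on `r - I(x)` is witnessed by a slope. -/
theorem exists_slope_of_sub_legendre_lt (C : (Fin q → ℝ) → ℝ) (x : Fin q → ℝ) {r V : ℝ}
    (h : (r : EReal) - legendre C x < V) : ∃ t : Fin q → ℝ, r - (∑ j, t j * x j - C t) < V := by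
  by_contra! hcon
  refine absurd h (not_lt.mpr ?_)
  have : legendre C x ≤ ((r - V : ℝ) : EReal) := by
    refine iSup_le fun t => EReal.coe_le_coe_iff.mpr ?_
    linarith [hcon t]
  calc (V : EReal) = ((r - (r - V) : ℝ) : EReal) := by norm_num
    _ = (r : EReal) - ((r - V : ℝ) : EReal) := EReal.coe_sub _ _
    _ ≤ _ := EReal.sub_le_sub le_rfl this

/-- A strict lower bound on `r - I(x)` forces `I(x)` to be finite. -/
theorem exists_bound_of_lt_sub_legendre (C : (Fin q → ℝ) → ℝ) (x : Fin q → ℝ) {r V : ℝ}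
    (h : (V : EReal) < (r : EReal) - legendre C x) :
    ∃ B : ℝ, (∀ t : Fin q → ℝ, ∑ j, t j * x j - C t ≤ B) ∧ V < r - B := by
  have hb := legendre_ne_bot C x
  have ht : legendre C x ≠ ⊤ := fun ht => by
    rw [ht, EReal.sub_top] at h
    exact not_lt_bot h
  lift legendre C x to ℝ using ⟨ht, hb⟩ with B hB
  refine ⟨B, fun t => ?_, ?_⟩
  · have := le_legendre C x t
    rw [← hB] at this
    exact_mod_cast this
  · exact_mod_cast h

end Legendre

/-! ### Assembly of the two bounds -/

/-- The variational formula and the limit, for functions that are continuous on intervals bounding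
the matrices. -/
theorem exists_tendsto_logTrExp {m q : ℕ} [NeZero m] {X : Fin q → Matrix (Fin m) (Fin m) ℂ}
    (hX : ∀ j, (X j).IsHermitian) {F : Fin q → ℝ → ℝ} (hF : ∀ j, Continuous (F j))
    {lo hi : Fin q → ℝ} (hlohi : ∀ j, lo j ≤ hi j) (hlo : ∀ j, lo j • 1 ≤ X j)
    (hhi : ∀ j, X j ≤ hi j • 1) :
    ∃ L : ℝ, (L : EReal) = ⨆ x ∈ Set.Icc lo hi,
        (((∑ j, F j (x j) : ℝ) : EReal) - legendre (cgf X) x) ∧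
      Tendsto (fun n : ℕ => (1 / ((n + 1 : ℕ) : ℝ)) * logTrExp (((n + 1 : ℕ) : ℂ) •
        ∑ j, cfc (F j) (mean (n + 1) (X j)))) atTop (𝓝 L) := by
  set S : EReal := ⨆ x ∈ Set.Icc lo hi,
    (((∑ j, F j (x j) : ℝ) : EReal) - legendre (cgf X) x) with hS
  have hΨ : Continuous fun y : Fin q → ℝ => ∑ j, F j (y j) := by fun_prop
  have hle : ∀ x ∈ Set.Icc lo hi, ((∑ j, F j (x j) : ℝ) : EReal) - legendre (cgf X) x ≤ S :=
    fun x hx => le_iSup₂ (f := fun (x : Fin q → ℝ) (_ : x ∈ Set.Icc lo hi) =>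
      ((∑ j, F j (x j) : ℝ) : EReal) - legendre (cgf X) x) x hx
  have htop : S ≠ ⊤ := by
    obtain ⟨M, hM⟩ := (isCompact_Icc (a := lo) (b := hi)).exists_bound_of_continuousOn
      hΨ.continuousOn
    refine ne_top_of_le_ne_top (EReal.coe_ne_top (M + cgf X 0)) (iSup₂_le fun x hx => ?_)
    refine (coe_sub_legendre_le (cgf X) x 0 _).trans (EReal.coe_le_coe_iff.mpr ?_)
    have := (le_abs_self _).trans (hM x hx)
    simp only [Pi.zero_apply, zero_mul, Finset.sum_const_zero]
    linarith
  -- The gradient at `t = 0` lies in the box, and the subgradient inequality bounds its rate by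
  -- `-C(0)`.
  have hbot : S ≠ ⊥ := by
    have hY := isHermitian_sum_smul hX 0
    have hmem : cgfGrad X 0 ∈ Set.Icc lo hi := by
      refine ⟨fun j => ?_, fun j => ?_⟩
      · have := gibbs_mono hY (hlo j)
        rwa [gibbs_smul, gibbs_one hY, mul_one] at this
      · have := gibbs_mono hY (hhi j)
        rwa [gibbs_smul, gibbs_one hY, mul_one] at this
    refine ne_bot_of_le_ne_bot ?_ (hle _ hmem)
    have hI : legendre (cgf X) (cgfGrad X 0) ≤ ((-cgf X 0 : ℝ) : EReal) := by
      refine iSup_le fun t => EReal.coe_le_coe_iff.mpr ?_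
      have := cgf_add_le hX 0 t
      simp only [Pi.zero_apply, sub_zero] at this
      linarith
    refine ne_bot_of_le_ne_bot ?_ (EReal.sub_le_sub le_rfl hI)
    rw [← EReal.coe_sub]
    exact EReal.coe_ne_bot _
  obtain ⟨L, hL⟩ : ∃ L : ℝ, (L : EReal) = S := ⟨S.toReal, EReal.coe_toReal htop hbot⟩
  refine ⟨L, hL, tendsto_order.mpr ⟨fun a ha => ?_, fun b hb => ?_⟩⟩
  · obtain ⟨a', haa', ha'⟩ := exists_between ha
    have : (a' : EReal) < S := by rw [← hL]; exact_mod_cast ha'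
    obtain ⟨x, hx⟩ := lt_iSup_iff.mp this
    obtain ⟨-, hx⟩ := lt_iSup_iff.mp hx
    obtain ⟨B, hB, hVB⟩ := exists_bound_of_lt_sub_legendre _ _ hx
    filter_upwards [eventually_le_logTrExp hX hF hB (sub_pos.mpr haa')] with n hn
    linarith
  · have hε : 0 < (b - L) / 3 := by linarith
    have hV : ∀ x ∈ Set.Icc lo hi, ∃ t : Fin q → ℝ,
        ∑ j, F j (x j) - (∑ j, t j * x j - cgf X t) < L + (b - L) / 3 := fun x hx => by
      refine exists_slope_of_sub_legendre_lt _ _ ((hle x hx).trans_lt ?_)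
      rw [← hL]
      exact_mod_cast lt_add_of_pos_right L hε
    filter_upwards [eventually_logTrExp_le hX hF hlohi hlo hhi hV hε] with n hn
    linarith

end QuantumLD

end

theorem mainTheorem2 (m q : ℕ) (hm : 0 < m)
    (X : Fin q → Matrix (Fin m) (Fin m) ℂ) (hX : ∀ j, (X j).IsHermitian)
    (f : Fin q → ℝ → ℝ)
    (hf : ∀ j, ContinuousOn (f j) (convexHull ℝ (spectrum ℝ (X j)))) :
    ∃ L : ℝ,
      (L : EReal) =
          ⨆ x ∈ {x : Fin q → ℝ | ∀ j, x j ∈ convexHull ℝ (spectrum ℝ (X j))},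
            (((∑ j, f j (x j) : ℝ) : EReal) - QuantumLD.legendre (QuantumLD.cgf X) x) ∧
      Tendsto
        (fun n : ℕ => (1 / (n : ℝ)) *
          QuantumLD.logTrExp ((n : ℂ) • ∑ j, cfc (f j) (QuantumLD.mean n (X j))))
        atTop (𝓝 L) := by
  have : NeZero m := ⟨hm.ne'⟩
  choose lo hi hlohi hhull hlo hhi using fun j =>
    QuantumLD.exists_convexHull_spectrum_eq_Icc (hX j)
  choose F hF hFf using fun j =>
    QuantumLD.exists_continuous_eqOn_Icc (hlohi j) (hhull j ▸ hf j)
  obtain ⟨L, hL, hlim⟩ := QuantumLD.exists_tendsto_logTrExp hX hF hlohi hlo hhi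
  have hset : {x : Fin q → ℝ | ∀ j, x j ∈ convexHull ℝ (spectrum ℝ (X j))} = Set.Icc lo hi := by
    ext x
    simp only [hhull, Set.mem_ofPred_eq, Set.mem_Icc, Pi.le_def]
    exact forall_and
  -- The limit was proved along `n + 1`, which excludes the degenerate `n = 0`; the shift does not
  -- affect it.
  refine ⟨L, ?_, (tendsto_add_atTop_iff_nat 1).mp (hlim.congr fun n => ?_)⟩
  · rw [hL, hset]
    refine iSup_congr fun x => iSup_congr fun hx => ?_
    rw [Finset.sum_congr rfl fun j _ => hFf j ⟨hx.1 j, hx.2 j⟩]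
  · rw [Finset.sum_congr rfl fun j _ => cfc_congr fun x hx =>
      hFf j (QuantumLD.spectrum_mean_subset n.succ_pos (hX j) (hlo j) (hhi j) hx)]
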